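/- Let $k$ be a field of characteristic zero, let $n\ge 0$, and let $G$ be a finite group acting linearly on $k^n$ through a homomorphism $\rho: G\to GL_n(k)$ (not assumed injective). Then $G$ acts on $k[x_1,\dots,x_n]$ by $(g\cdot f)(v)=f(\rho(g)^{-1}v)$, that is, $g\cdot x_i=\sum_j(\rho(g)^{-1})_{ij}x_j$. Let $A_n(k)$ be the $n$-th Weyl algebra, i.e. the unital associative $k$-algebra generated by $x_1,\dots,x_n,\partial_1,\dots,\partial_n$ with relations $\partial_ix_j-x_j\partial_i=\delta_{ij}$, $x_ix_j=x_jx_i$, $\partial_i\partial_j=\partial_j\partial_i$. The action extends to $A_n(k)$, viewed as the algebra of differential operators on $k[x_1,\dots,x_n]$, by conjugation, that is, $g\cdot\partial_i=\sum_j\rho(g)_{ji}\partial_j$, and then to the skew field of fractions $F_n(k)$ of the Ore domain $A_n(k)$ (the Weyl field). Suppose that the quotient variety $\mathbb A^n(k)/G=\operatorname{Spec} k[x_1,\dots,x_n]^G$ is rational, that is, for some $m$ there is an isomorphism of $k$-algebras $\operatorname{Frac}(k[x_1,\dots,x_n]^G)\cong k(t_1,\dots,t_m)$. Then there is an isomorphism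 of $k$-algebras $$F_n(k)^G\cong F_n(k).$$ -/

import Mathlib

/-! ### The Weyl algebra by generators and relations -/

/-- The defining relations of the `n`-th Weyl algebra, on the free algebra with generators
`xᵢ` (the letters `Sum.inl i`) and `∂ᵢ` (the letters `Sum.inr i`). -/
inductive WeylRel (n : ℕ) (k : Type*) [Field k] :
    FreeAlgebra k (Fin n ⊕ Fin n) → FreeAlgebra k (Fin n ⊕ Fin n) → Prop
  | xx (i j : Fin n) : WeylRel n k
      (FreeAlgebra.ι k (Sum.inl i) * FreeAlgebra.ι k (Sum.inl j))
      (FreeAlgebra.ι k (Sum.inl j) * FreeAlgebra.ι k (Sum.inl i))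
  | dd (i j : Fin n) : WeylRel n k
      (FreeAlgebra.ι k (Sum.inr i) * FreeAlgebra.ι k (Sum.inr j))
      (FreeAlgebra.ι k (Sum.inr j) * FreeAlgebra.ι k (Sum.inr i))
  | dx (i j : Fin n) : WeylRel n k
      (FreeAlgebra.ι k (Sum.inr i) * FreeAlgebra.ι k (Sum.inl j)
        - FreeAlgebra.ι k (Sum.inl j) * FreeAlgebra.ι k (Sum.inr i))
      (if i = j then 1 else 0)

/-- The `n`-th Weyl algebra `Aₙ(k)`. -/
def WeylAlgebra (n : ℕ) (k : Type*) [Field k] : Type _ := RingQuot (WeylRel n k)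

namespace WeylAlgebra

noncomputable instance (n : ℕ) (k : Type*) [Field k] : Ring (WeylAlgebra n k) :=
  inferInstanceAs (Ring (RingQuot (WeylRel n k)))

noncomputable instance (n : ℕ) (k : Type*) [Field k] : Algebra k (WeylAlgebra n k) :=
  inferInstanceAs (Algebra k (RingQuot (WeylRel n k)))

variable {n : ℕ} {k : Type*} [Field k]

variable (k) in
/-- The generator `xᵢ` of the Weyl algebra. -/
noncomputable def x (i : Fin n) : WeylAlgebra n k :=
  RingQuot.mkAlgHom k (WeylRel n k) (FreeAlgebra.ι k (Sum.inl i))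

variable (k) in
/-- The generator `∂ᵢ` of the Weyl algebra. -/
noncomputable def d (i : Fin n) : WeylAlgebra n k :=
  RingQuot.mkAlgHom k (WeylRel n k) (FreeAlgebra.ι k (Sum.inr i))

theorem x_mul_x (i j : Fin n) : x k i * x k j = x k j * x k i := by
  have h := RingQuot.mkAlgHom_rel k (WeylRel.xx (k := k) i j)
  rw [map_mul, map_mul] at h
  exact h

theorem d_mul_d (i j : Fin n) : d k i * d k j = d k j * d k i := by
  have h := RingQuot.mkAlgHom_rel k (WeylRel.dd (k := k) i j)
  rw [map_mul, map_mul] at h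
  exact h

theorem d_mul_x_sub (i j : Fin n) :
    d k i * x k j - x k j * d k i = if i = j then 1 else 0 := by
  have h := RingQuot.mkAlgHom_rel k (WeylRel.dx (k := k) i j)
  rw [map_sub, map_mul, map_mul] at h
  refine h.trans ?_
  split_ifs
  · exact map_one _
  · exact map_zero _

/-- The universal property of the Weyl algebra: elements `a i`, `b i` satisfying the defining
relations give an algebra homomorphism with `xᵢ ↦ a i` and `∂ᵢ ↦ b i`. -/
noncomputable def lift {B : Type*} [Ring B] [Algebra k B] (a b : Fin n → B)
    (haa : ∀ i j, a i * a j = a j * a i) (hbb : ∀ i j, b i * b j = b j * b i)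
    (hba : ∀ i j, b i * a j - a j * b i = if i = j then 1 else 0) :
    WeylAlgebra n k →ₐ[k] B :=
  RingQuot.liftAlgHom k ⟨FreeAlgebra.lift k (Sum.elim a b), by
    rintro _ _ (⟨i, j⟩ | ⟨i, j⟩ | ⟨i, j⟩)
    · simpa using haa i j
    · simpa using hbb i j
    · rw [map_sub, map_mul, map_mul]
      simp only [FreeAlgebra.lift_ι_apply, Sum.elim_inl, Sum.elim_inr]
      rw [hba]
      split_ifs <;> simp⟩

section lift

variable {B : Type*} [Ring B] [Algebra k B] (a b : Fin n → B)
    (haa : ∀ i j, a i * a j = a j * a i) (hbb : ∀ i j, b i * b j = b j * b i)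
    (hba : ∀ i j, b i * a j - a j * b i = if i = j then 1 else 0)

@[simp] theorem lift_x (i : Fin n) : lift (k := k) a b haa hbb hba (x k i) = a i := by
  unfold lift x
  erw [RingQuot.liftAlgHom_mkAlgHom_apply]
  simp

@[simp] theorem lift_d (i : Fin n) : lift (k := k) a b haa hbb hba (d k i) = b i := by
  unfold lift d
  erw [RingQuot.liftAlgHom_mkAlgHom_apply]
  simp

end lift

theorem algHom_ext {B : Type*} [Ring B] [Algebra k B] {f g : WeylAlgebra n k →ₐ[k] B}
    (hx : ∀ i, f (x k i) = g (x k i)) (hd : ∀ i, f (d k i) = g (d k i)) : f = g := by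
  refine RingQuot.ringQuot_ext' k _ _ (FreeAlgebra.hom_ext (funext ?_))
  rintro (i | i)
  · exact hx i
  · exact hd i

theorem induction {p : WeylAlgebra n k → Prop}
    (hx : ∀ i, p (x k i)) (hd : ∀ i, p (d k i)) (hc : ∀ c, p (algebraMap k _ c))
    (hadd : ∀ a b, p a → p b → p (a + b)) (hmul : ∀ a b, p a → p b → p (a * b))
    (P : WeylAlgebra n k) : p P := by
  obtain ⟨w, rfl⟩ := RingQuot.mkAlgHom_surjective k (WeylRel n k) P
  induction w using FreeAlgebra.induction with
  | grade0 c =>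
    rw [AlgHom.commutes]
    exact hc c
  | grade1 i =>
    rcases i with i | i
    · exact hx i
    · exact hd i
  | mul a b ha hb => rw [map_mul]; exact hmul _ _ ha hb
  | add a b ha hb => rw [map_add]; exact hadd _ _ ha hb

/-! ### The Weyl algebra is an Ore domain

The Weyl algebra acts on the commutative polynomials in `xᵢ, ξᵢ` by `xᵢ ↦ xᵢ` and
`∂ᵢ ↦ ξᵢ + ∂/∂xᵢ`. -/

open MvPolynomial

/-- Auxiliary representation on the commutative polynomials in `xᵢ, ξᵢ`. -/
noncomputable def rep : WeylAlgebra n k →ₐ[k] Module.End k (MvPolynomial (Fin n ⊕ Fin n) k) :=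
  lift (fun i => LinearMap.mulLeft k (X (Sum.inl i)))
    (fun i => LinearMap.mulLeft k (X (Sum.inr i)) + (pderiv (Sum.inl i)).toLinearMap)
    (fun i j => by
      refine LinearMap.ext fun f => ?_
      simp only [Module.End.mul_apply, LinearMap.mulLeft_apply]
      ring)
    (fun i j => by
      refine LinearMap.ext fun f => ?_
      have hc : pderiv (Sum.inl i) (pderiv (Sum.inl j) f)
          = pderiv (Sum.inl j) (pderiv (Sum.inl i) f) := by
        have h : ⁅pderiv (R := k) (Sum.inl i : Fin n ⊕ Fin n),
            pderiv (R := k) (Sum.inl j : Fin n ⊕ Fin n)⁆ = 0 := by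
          refine MvPolynomial.derivation_ext fun l => ?_
          simp only [Derivation.commutator_apply, pderiv_X, Derivation.zero_apply]
          rw [Pi.single_apply, Pi.single_apply]
          split_ifs <;> simp
        have := DFunLike.congr_fun h f
        rw [Derivation.commutator_apply] at this
        exact sub_eq_zero.mp this
      simp only [Module.End.mul_apply, LinearMap.add_apply, LinearMap.mulLeft_apply,
        Derivation.coeFn_coe, map_add, Derivation.leibniz, hc, smul_eq_mul]
      rw [pderiv_X_of_ne (by simp), pderiv_X_of_ne (by simp)]
      ring)
    (fun i j => by
      refine LinearMap.ext fun f => ?_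
      simp only [Module.End.mul_apply, LinearMap.add_apply, LinearMap.mulLeft_apply,
        LinearMap.sub_apply, Derivation.coeFn_coe, Derivation.leibniz, smul_eq_mul]
      split_ifs with h
      · subst h; rw [pderiv_X_self]; simp; ring
      · rw [pderiv_X_of_ne (by simpa using Ne.symm h)]; simp; ring)

theorem rep_x (i : Fin n) (f : MvPolynomial (Fin n ⊕ Fin n) k) :
    rep (x k i) f = X (Sum.inl i) * f := by
  simp [rep]

theorem rep_d (i : Fin n) (f : MvPolynomial (Fin n ⊕ Fin n) k) :
    rep (d k i) f = X (Sum.inr i) * f + pderiv (Sum.inl i) f := by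
  simp [rep]

open scoped IsMulCommutative in
theorem exists_aeval_of_commute {B : Type*} [Ring B] [Algebra k B] (a : Fin n → B)
    (haa : ∀ i j, a i * a j = a j * a i) :
    ∃ φ : MvPolynomial (Fin n) k →ₐ[k] B, ∀ i, φ (X i) = a i := by
  have hcomm := Algebra.isMulCommutative_adjoin k (s := Set.range a) (by
    rintro _ ⟨i, rfl⟩ _ ⟨j, rfl⟩; exact haa i j)
  let b : Fin n → Algebra.adjoin k (Set.range a) :=
    fun i => ⟨a i, Algebra.subset_adjoin ⟨i, rfl⟩⟩
  refine ⟨(Algebra.adjoin k (Set.range a)).val.comp (aeval (R := k) b), fun i => ?_⟩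
  rw [AlgHom.comp_apply, aeval_X]
  rfl

/-- Auxiliary: substitution of the commuting elements `xᵢ`. -/
noncomputable def evalX : MvPolynomial (Fin n) k →ₐ[k] WeylAlgebra n k :=
  (exists_aeval_of_commute (x k) x_mul_x).choose

/-- Auxiliary: substitution of the commuting elements `∂ᵢ`. -/
noncomputable def evalD : MvPolynomial (Fin n) k →ₐ[k] WeylAlgebra n k :=
  (exists_aeval_of_commute (d k) d_mul_d).choose

theorem evalX_X (i : Fin n) : evalX (X i) = x k i :=
  (exists_aeval_of_commute (x k) x_mul_x).choose_spec i

theorem evalD_X (i : Fin n) : evalD (X i) = d k i :=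
  (exists_aeval_of_commute (d k) d_mul_d).choose_spec i

theorem d_mul_evalX (i : Fin n) (p : MvPolynomial (Fin n) k) :
    d k i * evalX p = evalX p * d k i + evalX (pderiv i p) := by
  induction p using MvPolynomial.induction_on with
  | C c =>
    rw [pderiv_C, map_zero, add_zero]
    have : evalX (C c) = algebraMap k (WeylAlgebra n k) c := by
      rw [← MvPolynomial.algebraMap_eq]; exact evalX.commutes c
    rw [this, Algebra.commutes]
  | add p q hp hq => simp only [map_add, mul_add, add_mul, hp, hq]; abel
  | mul_X p j hp =>
    have h := d_mul_x_sub (k := k) i j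
    rw [sub_eq_iff_eq_add] at h
    rw [Derivation.leibniz, map_mul, map_add, smul_eq_mul, smul_eq_mul, map_mul, evalX_X,
      ← mul_assoc, hp, add_mul, mul_assoc, h, mul_add, ← mul_assoc, pderiv_X]
    have h2 : evalX (X j * pderiv i p) = evalX (pderiv i p) * x k j := by
      rw [mul_comm, map_mul, evalX_X]
    rw [h2]
    by_cases hij : i = j
    · subst hij; simp; abel
    · simp [hij, Ne.symm hij]

/-- Auxiliary: the normal ordering map, sending `x^a ξ^b` to `x^a ∂^b`. -/
noncomputable def normalOrder : MvPolynomial (Fin n ⊕ Fin n) k →ₗ[k] WeylAlgebra n k :=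
  (basisMonomials (Fin n ⊕ Fin n) k).constr k fun s : Fin n ⊕ Fin n →₀ ℕ =>
    evalX (monomial (Finsupp.sumFinsuppAddEquivProdFinsupp s).1 1) *
      evalD (monomial (Finsupp.sumFinsuppAddEquivProdFinsupp s).2 1)

theorem normalOrder_monomial (s : Fin n ⊕ Fin n →₀ ℕ) :
    normalOrder (monomial s (1 : k)) =
      evalX (monomial (Finsupp.sumFinsuppAddEquivProdFinsupp s).1 1) *
        evalD (monomial (Finsupp.sumFinsuppAddEquivProdFinsupp s).2 1) := by
  have := (basisMonomials (Fin n ⊕ Fin n) k).constr_basis k (fun s : Fin n ⊕ Fin n →₀ ℕ =>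
    evalX (monomial (Finsupp.sumFinsuppAddEquivProdFinsupp s).1 (1 : k)) *
      evalD (monomial (Finsupp.sumFinsuppAddEquivProdFinsupp s).2 1)) s
  simpa [normalOrder] using this

theorem normalOrder_one : normalOrder (1 : MvPolynomial (Fin n ⊕ Fin n) k) = 1 := by
  have h := normalOrder_monomial (k := k) (0 : Fin n ⊕ Fin n →₀ ℕ)
  simpa using h

theorem monomial_ext_aux {M : Type*} [AddCommGroup M] [Module k M]
    {f g : MvPolynomial (Fin n ⊕ Fin n) k →ₗ[k] M}
    (h : ∀ s, f (monomial s 1) = g (monomial s 1)) : f = g :=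
  (basisMonomials (Fin n ⊕ Fin n) k).ext fun s => by simpa using h s

theorem sumFinsupp_inl (i : Fin n) :
    Finsupp.sumFinsuppAddEquivProdFinsupp (Finsupp.single (Sum.inl i : Fin n ⊕ Fin n) 1)
      = (Finsupp.single i 1, (0 : Fin n →₀ ℕ)) := by
  classical
  ext j <;> simp [Finsupp.single_apply]

theorem sumFinsupp_inr (i : Fin n) :
    Finsupp.sumFinsuppAddEquivProdFinsupp (Finsupp.single (Sum.inr i : Fin n ⊕ Fin n) 1)
      = ((0 : Fin n →₀ ℕ), Finsupp.single i 1) := by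
  classical
  ext j <;> simp [Finsupp.single_apply]

theorem x_mul_normalOrder (i : Fin n) (f : MvPolynomial (Fin n ⊕ Fin n) k) :
    x k i * normalOrder f = normalOrder (X (Sum.inl i) * f) := by
  suffices h : (LinearMap.mulLeft k (x k i)).comp normalOrder
      = normalOrder.comp (LinearMap.mulLeft k (X (Sum.inl i))) from DFunLike.congr_fun h f
  refine monomial_ext_aux fun s => ?_
  simp only [LinearMap.comp_apply, LinearMap.mulLeft_apply]
  have h1 : (X (Sum.inl i) : MvPolynomial (Fin n ⊕ Fin n) k) * monomial s 1
      = monomial (Finsupp.single (Sum.inl i) 1 + s) 1 := by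
    rw [X, monomial_mul, one_mul]
  have h2 : (monomial (Finsupp.single i 1 + (Finsupp.sumFinsuppAddEquivProdFinsupp s).1) (1 : k))
      = X i * monomial (Finsupp.sumFinsuppAddEquivProdFinsupp s).1 1 := by
    rw [X, monomial_mul, one_mul]
  rw [h1, normalOrder_monomial, normalOrder_monomial, map_add, sumFinsupp_inl]
  simp only [Prod.fst_add, Prod.snd_add, zero_add]
  rw [h2, map_mul, evalX_X, mul_assoc]

theorem d_mul_normalOrder (i : Fin n) (f : MvPolynomial (Fin n ⊕ Fin n) k) :
    d k i * normalOrder f = normalOrder (X (Sum.inr i) * f + pderiv (Sum.inl i) f) := by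
  suffices h : (LinearMap.mulLeft k (d k i)).comp normalOrder
      = normalOrder.comp (LinearMap.mulLeft k (X (Sum.inr i)) +
        (pderiv (Sum.inl i)).toLinearMap) from DFunLike.congr_fun h f
  refine monomial_ext_aux fun s => ?_
  simp only [LinearMap.comp_apply, LinearMap.mulLeft_apply, LinearMap.add_apply,
    Derivation.coeFn_coe, map_add]
  have h1 : (X (Sum.inr i) : MvPolynomial (Fin n ⊕ Fin n) k) * monomial s 1
      = monomial (Finsupp.single (Sum.inr i) 1 + s) 1 := by
    rw [X, monomial_mul, one_mul]
  have h2 : (monomial (Finsupp.single i 1 + (Finsupp.sumFinsuppAddEquivProdFinsupp s).2) (1 : k))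
      = X i * monomial (Finsupp.sumFinsuppAddEquivProdFinsupp s).2 1 := by
    rw [X, monomial_mul, one_mul]
  have h3 : normalOrder (pderiv (Sum.inl i) (monomial s (1 : k)))
      = evalX (pderiv i (monomial (Finsupp.sumFinsuppAddEquivProdFinsupp s).1 1)) *
        evalD (monomial (Finsupp.sumFinsuppAddEquivProdFinsupp s).2 1) := by
    have e : ∀ {τ : Type} (t : τ →₀ ℕ) (c : k), monomial t c = c • monomial t (1 : k) :=
      fun t c => by rw [smul_monomial, smul_eq_mul, mul_one]
    have hs : Finsupp.sumFinsuppAddEquivProdFinsupp (s - Finsupp.single (Sum.inl i) 1)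
        = ((Finsupp.sumFinsuppAddEquivProdFinsupp s).1 - Finsupp.single i 1,
          (Finsupp.sumFinsuppAddEquivProdFinsupp s).2) := by
      classical
      ext j <;> simp [Finsupp.single_apply]
    rw [pderiv_monomial, pderiv_monomial, one_mul, one_mul, e _ (s (Sum.inl i) : k), map_smul,
      normalOrder_monomial, hs, Finsupp.fst_sumFinsuppAddEquivProdFinsupp,
      e ((Finsupp.sumFinsuppAddEquivProdFinsupp s).1 - _) (s (Sum.inl i) : k), map_smul,
      smul_mul_assoc]
  rw [h3, h1, normalOrder_monomial, normalOrder_monomial, map_add, sumFinsupp_inr]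
  simp only [Prod.fst_add, Prod.snd_add, zero_add]
  rw [h2, map_mul, evalD_X, ← mul_assoc, d_mul_evalX, add_mul, mul_assoc]

theorem mul_normalOrder (P : WeylAlgebra n k) (f : MvPolynomial (Fin n ⊕ Fin n) k) :
    P * normalOrder f = normalOrder (rep P f) := by
  induction P using WeylAlgebra.induction generalizing f with
  | hx i => rw [rep_x, x_mul_normalOrder]
  | hd i => rw [rep_d, d_mul_normalOrder]
  | hc c =>
    rw [AlgHom.commutes, Module.algebraMap_end_apply, map_smul, Algebra.smul_def]
  | hadd a b ha hb => rw [add_mul, ha, hb, map_add, LinearMap.add_apply, map_add]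
  | hmul a b ha hb => rw [mul_assoc, hb, ha, map_mul, Module.End.mul_apply]

theorem normalOrder_rep_one (P : WeylAlgebra n k) : normalOrder (rep P 1) = P := by
  rw [← mul_normalOrder, normalOrder_one, mul_one]

variable (n k) in
/-- Auxiliary: the polynomials of total degree less than `N`. -/
noncomputable def degLT (N : ℕ) : Submodule k (MvPolynomial (Fin n ⊕ Fin n) k) :=
  restrictSupport k {s | s.degree < N}

theorem mem_degLT {N : ℕ} {f : MvPolynomial (Fin n ⊕ Fin n) k} :
    f ∈ degLT n k N ↔ ∀ s ∈ f.support, s.degree < N := Iff.rfl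

theorem degLT_mono {M N : ℕ} (h : M ≤ N) : degLT n k M ≤ degLT n k N :=
  fun _ hf _ hs => lt_of_lt_of_le (hf hs) h

theorem mem_degLT_of_totalDegree {f : MvPolynomial (Fin n ⊕ Fin n) k} {e : ℕ}
    (h : f.totalDegree ≤ e) : f ∈ degLT n k (e + 1) := by
  intro s hs
  have := (le_totalDegree (p := f) hs).trans h
  rw [Set.mem_ofPred_eq, Finsupp.degree_eq_sum, ← Finsupp.sum_fintype s (fun _ e => e) (by simp)]
  omega

theorem totalDegree_lt_of_mem {f : MvPolynomial (Fin n ⊕ Fin n) k} {e : ℕ}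
    (hf : f ≠ 0) (h : f ∈ degLT n k e) : f.totalDegree < e := by
  obtain ⟨_, hs⟩ := (support_nonempty.mpr hf)
  have h0 : 0 < e := lt_of_le_of_lt (Nat.zero_le _) (h hs)
  rw [totalDegree, Finset.sup_lt_iff h0]
  intro s hs
  have := h hs
  rwa [Set.mem_ofPred_eq, Finsupp.degree_eq_sum,
    ← Finsupp.sum_fintype s (fun _ e => e) (by simp)] at this

theorem X_mul_mem_degLT {N : ℕ} {f : MvPolynomial (Fin n ⊕ Fin n) k} (j : Fin n ⊕ Fin n)
    (hf : f ∈ degLT n k N) : X j * f ∈ degLT n k (N + 1) := by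
  classical
  intro s hs
  change s ∈ (X j * f).support at hs
  rw [support_X_mul, Finset.mem_map] at hs
  obtain ⟨t, ht, rfl⟩ := hs
  have : t.degree < N := hf ht
  simp only [addLeftEmbedding_apply, Set.mem_ofPred_eq, map_add, Finsupp.degree_single]
  omega

theorem pderiv_mem_degLT {N : ℕ} {f : MvPolynomial (Fin n ⊕ Fin n) k} (j : Fin n ⊕ Fin n)
    (hf : f ∈ degLT n k (N + 1)) : pderiv j f ∈ degLT n k N := by
  rw [degLT, restrictSupport_eq_span] at hf
  induction hf using Submodule.span_induction with
  | mem f hf =>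
    obtain ⟨s, hs, rfl⟩ := hf
    rw [Set.mem_ofPred_eq] at hs
    dsimp only
    rw [pderiv_monomial, degLT, monomial_mem_restrictSupport]
    by_cases h : s j = 0
    · right; simp [h]
    · left
      have h1 : s - Finsupp.single j 1 + Finsupp.single j 1 = s :=
        tsub_add_cancel_of_le (by simpa [Nat.one_le_iff_ne_zero] using h)
      have h2 := congrArg Finsupp.degree h1
      rw [map_add, Finsupp.degree_single] at h2
      rw [Set.mem_ofPred_eq]
      omega
  | zero => simp
  | add f g _ _ hf hg => rw [map_add]; exact add_mem hf hg
  | smul c f _ hf => rw [Derivation.map_smul]; exact Submodule.smul_mem _ _ hf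

theorem rep_normalOrder_sub_mem (D e : ℕ) :
    ∀ h ∈ degLT n k (D + 1), ∀ f ∈ degLT n k (e + 1),
      rep (normalOrder h) f - h * f ∈ degLT n k (D + e) ∧ h * f ∈ degLT n k (D + e + 1) := by
  induction D using Nat.strong_induction_on with
  | _ D ih =>
  intro h hh f hf
  rw [degLT, restrictSupport_eq_span] at hh
  induction hh using Submodule.span_induction with
  | zero => simp
  | add a b _ _ ha hb =>
    refine ⟨?_, ?_⟩
    · have : rep (normalOrder (a + b)) f - (a + b) * f
          = (rep (normalOrder a) f - a * f) + (rep (normalOrder b) f - b * f) := by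
        rw [map_add, map_add, LinearMap.add_apply]; ring
      rw [this]; exact add_mem ha.1 hb.1
    · rw [add_mul]; exact add_mem ha.2 hb.2
  | smul c a _ ha =>
    refine ⟨?_, ?_⟩
    · have : rep (normalOrder (c • a)) f - (c • a) * f
          = c • (rep (normalOrder a) f - a * f) := by
        rw [map_smul, map_smul, LinearMap.smul_apply, smul_sub, smul_mul_assoc]
      rw [this]; exact Submodule.smul_mem _ _ ha.1
    · rw [smul_mul_assoc]; exact Submodule.smul_mem _ _ ha.2
  | mem h hh =>
    obtain ⟨s, hs, rfl⟩ := hh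
    rw [Set.mem_ofPred_eq] at hs
    dsimp only
    by_cases hs0 : s = 0
    · subst hs0
      have h1 : (monomial (0 : Fin n ⊕ Fin n →₀ ℕ) (1 : k)) = 1 := rfl
      rw [h1, normalOrder_one, map_one, Module.End.one_apply, one_mul, sub_self]
      exact ⟨zero_mem _, degLT_mono (by omega) hf⟩
    · obtain ⟨j, hj⟩ : ∃ j, s j ≠ 0 := by
        by_contra! hcon; exact hs0 (Finsupp.ext hcon)
      have h1 : Finsupp.single j 1 + (s - Finsupp.single j 1) = s :=
        add_tsub_cancel_of_le (by simpa [Nat.one_le_iff_ne_zero] using hj)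
      have h2 := congrArg Finsupp.degree h1
      rw [map_add, Finsupp.degree_single] at h2
      generalize s - Finsupp.single j 1 = t at h1 h2
      obtain ⟨E, rfl⟩ : ∃ E, D = E + 1 := ⟨D - 1, by omega⟩
      have hm : monomial s (1 : k) = X j * monomial t 1 := by
        rw [X, monomial_mul, one_mul, h1]
      have ht : monomial t (1 : k) ∈ degLT n k (E + 1) := by
        rw [degLT, monomial_mem_restrictSupport]; left
        rw [Set.mem_ofPred_eq]; omega
      obtain ⟨i1, i2⟩ := ih E (by omega) _ ht f hf
      have i3 : X j * (rep (normalOrder (monomial t (1 : k))) f - monomial t 1 * f)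
          ∈ degLT n k (E + 1 + e) := by
        have := X_mul_mem_degLT j i1
        exact degLT_mono (by omega) this
      have i4 : rep (normalOrder (monomial t (1 : k))) f ∈ degLT n k (E + e + 1) := by
        have := add_mem (degLT_mono (Nat.le_succ _) i1) i2
        simpa using this
      refine ⟨?_, ?_⟩
      · rw [hm]
        rcases j with i | i
        · rw [← x_mul_normalOrder, map_mul, Module.End.mul_apply, rep_x]
          rw [mul_sub, ← mul_assoc] at i3
          exact i3
        · have h3 : normalOrder (X (Sum.inr i) * monomial t (1 : k))
              = d k i * normalOrder (monomial t 1)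
                - normalOrder (pderiv (Sum.inl i) (monomial t 1)) := by
            rw [d_mul_normalOrder, map_add, add_sub_cancel_right]
          have i5 := pderiv_mem_degLT (Sum.inl i) i4
          have hp := pderiv_mem_degLT (Sum.inl i) ht
          have i6 : rep (normalOrder (pderiv (Sum.inl i) (monomial t (1 : k)))) f
              ∈ degLT n k (E + 1 + e) := by
            rcases E with _ | E
            · have h0 : pderiv (Sum.inl i) (monomial t (1 : k)) = 0 := by
                by_contra hne
                exact absurd (totalDegree_lt_of_mem hne hp) (by omega)
              rw [h0]; simp
            · obtain ⟨j1, j2⟩ := ih E (by omega) _ hp f hf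
              have := add_mem (degLT_mono (Nat.le_succ _) j1) j2
              rw [sub_add_cancel] at this
              exact degLT_mono (by omega) this
          have h4 : rep (normalOrder (X (Sum.inr i) * monomial t (1 : k))) f
              - X (Sum.inr i) * monomial t 1 * f
              = X (Sum.inr i) * (rep (normalOrder (monomial t (1 : k))) f - monomial t 1 * f)
                + pderiv (Sum.inl i) (rep (normalOrder (monomial t (1 : k))) f)
                - rep (normalOrder (pderiv (Sum.inl i) (monomial t (1 : k)))) f := by
            rw [h3, map_sub, LinearMap.sub_apply, map_mul, Module.End.mul_apply, rep_d]
            ring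
          rw [h4]
          exact sub_mem (add_mem i3 (degLT_mono (by omega) i5)) i6
      · rw [hm, mul_assoc]
        exact degLT_mono (by omega) (X_mul_mem_degLT j i2)

theorem rep_normalOrder_mem {D e : ℕ} {h f : MvPolynomial (Fin n ⊕ Fin n) k}
    (hh : h ∈ degLT n k (D + 1)) (hf : f ∈ degLT n k (e + 1)) :
    rep (normalOrder h) f ∈ degLT n k (D + e + 1) := by
  obtain ⟨j1, j2⟩ := rep_normalOrder_sub_mem D e _ hh f hf
  have := add_mem (degLT_mono (Nat.le_succ _) j1) j2
  rwa [sub_add_cancel] at this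

theorem rep_normalOrder_ne_zero {h f : MvPolynomial (Fin n ⊕ Fin n) k}
    (hh : h ≠ 0) (hf : f ≠ 0) : rep (normalOrder h) f ≠ 0 := by
  intro h0
  obtain ⟨j1, -⟩ := rep_normalOrder_sub_mem _ _ _ (mem_degLT_of_totalDegree (le_refl h.totalDegree))
    f (mem_degLT_of_totalDegree (le_refl f.totalDegree))
  rw [h0, zero_sub, neg_mem_iff] at j1
  have := totalDegree_lt_of_mem (mul_ne_zero hh hf) j1
  rw [totalDegree_mul_of_isDomain hh hf] at this
  exact lt_irrefl _ this

instance : Nontrivial (WeylAlgebra n k) :=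
  ⟨0, 1, fun h => by
    have := congrArg (fun P => rep P (1 : MvPolynomial (Fin n ⊕ Fin n) k)) h
    simp at this⟩

instance : NoZeroDivisors (WeylAlgebra n k) where
  eq_zero_or_eq_zero_of_mul_eq_zero {P Q} h := by
    by_contra! hcon
    have key : ∀ {P : WeylAlgebra n k}, P ≠ 0 → rep P 1 ≠ 0 := fun {P} hP h => hP (by
      rw [← normalOrder_rep_one P, h, map_zero])
    have h1 := rep_normalOrder_ne_zero (key hcon.1) (key hcon.2)
    rw [normalOrder_rep_one, ← Module.End.mul_apply, ← map_mul, h] at h1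
    simp at h1

theorem finite_degLT (N : ℕ) : Module.Finite k (degLT n k N) ∧
    Module.finrank k (degLT n k N) ≤ N ^ (2 * n) := by
  let φ : {s : Fin n ⊕ Fin n →₀ ℕ | s.degree < N} → (Fin n ⊕ Fin n → Fin N) := fun s j =>
    ⟨s.1 j, lt_of_le_of_lt (Finsupp.le_degree j s.1) s.2⟩
  have hφ : Function.Injective φ := by
    intro s t hst
    refine Subtype.ext (Finsupp.ext fun j => ?_)
    exact congrArg Fin.val (congrFun hst j)
  have : Finite {s : Fin n ⊕ Fin n →₀ ℕ | s.degree < N} := Finite.of_injective φ hφ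
  have := Fintype.ofFinite {s : Fin n ⊕ Fin n →₀ ℕ | s.degree < N}
  have b := basisRestrictSupport k {s : Fin n ⊕ Fin n →₀ ℕ | s.degree < N}
  refine ⟨Module.Finite.of_basis b, ?_⟩
  rw [degLT, Module.finrank_eq_card_basis b]
  refine (Fintype.card_le_of_injective φ hφ).trans ?_
  simp [two_mul]

/-- The left Ore condition. -/
theorem exists_left_common_multiple (r s : WeylAlgebra n k) (hs : s ≠ 0) :
    ∃ u v : WeylAlgebra n k, u ≠ 0 ∧ u * r = v * s := by
  by_contra! hcon
  have key : ∀ {P : WeylAlgebra n k}, rep P 1 = 0 → P = 0 := fun {P} h => by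
    rw [← normalOrder_rep_one P, h, map_zero]
  have hs' : rep s (1 : MvPolynomial (Fin n ⊕ Fin n) k) ≠ 0 := fun h => hs (key h)
  set e := max (rep r (1 : MvPolynomial (Fin n ⊕ Fin n) k)).totalDegree
    (rep s (1 : MvPolynomial (Fin n ⊕ Fin n) k)).totalDegree with he
  have hr1 := mem_degLT_of_totalDegree (le_max_left _ _ : _ ≤ e)
  have hs1 := mem_degLT_of_totalDegree (le_max_right _ _ : _ ≤ e)
  have step : ∀ D : ℕ, 2 * Module.finrank k (degLT n k (D + 1))
      ≤ Module.finrank k (degLT n k (D + e + 1)) := by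
    intro D
    have := (finite_degLT (n := n) (k := k) (D + 1)).1
    have := (finite_degLT (n := n) (k := k) (D + e + 1)).1
    let A : ∀ g : MvPolynomial (Fin n ⊕ Fin n) k, g ∈ degLT n k (e + 1) →
        (degLT n k (D + 1) →ₗ[k] degLT n k (D + e + 1)) := fun g hg =>
      LinearMap.codRestrict _
        ((LinearMap.applyₗ g).comp
          ((rep (n := n) (k := k)).toLinearMap.comp (normalOrder.comp (degLT n k (D + 1)).subtype)))
        (fun h => rep_normalOrder_mem h.2 hg)
    have hA : ∀ g hg h, (A g hg h : MvPolynomial (Fin n ⊕ Fin n) k) = rep (normalOrder h.1) g :=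
      fun _ _ _ => rfl
    let L : (degLT n k (D + 1) × degLT n k (D + 1)) →ₗ[k] degLT n k (D + e + 1) :=
      (A _ hr1).coprod (A _ hs1)
    have hL : Function.Injective L := by
      rw [injective_iff_map_eq_zero]
      rintro ⟨h1, h2⟩ h
      have h' := congrArg Subtype.val h
      simp only [L, LinearMap.coprod_apply, Submodule.coe_add, hA, ZeroMemClass.coe_zero] at h'
      have hu : normalOrder h1.1 = (0 : WeylAlgebra n k) := by
        by_contra hu
        refine hcon (normalOrder h1.1) (-normalOrder h2.1) hu ?_
        rw [← sub_eq_zero]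
        apply key
        rw [neg_mul, sub_neg_eq_add, map_add, map_mul, map_mul]
        exact h'
      have hz : ∀ h : MvPolynomial (Fin n ⊕ Fin n) k,
          rep (normalOrder h) (rep s 1) = 0 → h = 0 := fun h hh => by
        by_contra hne
        exact rep_normalOrder_ne_zero hne hs' hh
      have e1 : h1 = 0 := Subtype.ext (hz _ (by rw [hu]; simp))
      have e2 : h2 = 0 := Subtype.ext (hz _ (by simpa [hu] using h'))
      rw [e1, e2]; rfl
    have := LinearMap.finrank_le_finrank_of_injective hL
    rw [Module.finrank_prod] at this
    omega
  have low : ∀ j : ℕ, 2 ^ j ≤ Module.finrank k (degLT n k (j * e + 1)) := by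
    intro j
    induction j with
    | zero =>
      have := (finite_degLT (n := n) (k := k) (0 * e + 1)).1
      have h1 : (1 : MvPolynomial (Fin n ⊕ Fin n) k) ∈ degLT n k (0 * e + 1) :=
        mem_degLT_of_totalDegree (by simp)
      have : Nontrivial (degLT n k (0 * e + 1)) :=
        ⟨⟨⟨1, h1⟩, 0, fun h => one_ne_zero (congrArg Subtype.val h)⟩⟩
      have := Module.finrank_pos (R := k) (M := degLT n k (0 * e + 1))
      rw [pow_zero]; exact this
    | succ j ih =>
      have h1 := step (j * e)
      have h2 : j * e + e + 1 = (j + 1) * e + 1 := by ring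
      rw [h2] at h1
      rw [pow_succ]; omega
  have bound : ∀ j : ℕ, 2 ^ j ≤ (j * e + 1) ^ (2 * n) := fun j =>
    (low j).trans (finite_degLT _).2
  have lim := tendsto_pow_const_div_const_pow_of_one_lt (2 * n) (r := (2 : ℝ)) (by norm_num)
  have hpos : (0 : ℝ) < 1 / ((e + 1 : ℝ) ^ (2 * n)) := by positivity
  obtain ⟨j, hj, hj1⟩ := ((lim.eventually (gt_mem_nhds hpos)).and
    (Filter.eventually_ge_atTop 1)).exists
  rw [div_lt_div_iff₀ (by positivity) (by positivity), one_mul, ← mul_pow] at hj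
  have hb : ((2 : ℝ)) ^ j ≤ (j * e + 1) ^ (2 * n) := by exact_mod_cast bound j
  have hc : ((j : ℝ) * e + 1) ^ (2 * n) ≤ (j * (e + 1)) ^ (2 * n) := by
    have : (1 : ℝ) ≤ j := by exact_mod_cast hj1
    gcongr
    nlinarith
  linarith

noncomputable instance : OreLocalization.OreSet (nonZeroDivisors (WeylAlgebra n k)) :=
  OreLocalization.oreSetOfNoZeroDivisors
    (fun r s => (exists_left_common_multiple r s.1 (nonZeroDivisors.ne_zero s.2)).choose_spec.choose)
    (fun r s => ⟨(exists_left_common_multiple r s.1 (nonZeroDivisors.ne_zero s.2)).choose,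
      mem_nonZeroDivisors_of_ne_zero
        (exists_left_common_multiple r s.1 (nonZeroDivisors.ne_zero s.2)).choose_spec.choose_spec.1⟩)
    (fun r s =>
      (exists_left_common_multiple r s.1
        (nonZeroDivisors.ne_zero s.2)).choose_spec.choose_spec.2)

end WeylAlgebra

/-! ### The Weyl field -/

/-- The `n`-th Weyl field `Fₙ(k)`: the skew field of fractions of the Weyl algebra `Aₙ(k)`, that
is, its Ore localization at all nonzero elements. -/
abbrev WeylField (n : ℕ) (k : Type*) [Field k] : Type _ :=
  OreLocalization (nonZeroDivisors (WeylAlgebra n k)) (WeylAlgebra n k)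

namespace WeylField

open OreLocalization

variable {n : ℕ} {k : Type*} [Field k]

theorem algHom_ext {f g : WeylField n k →ₐ[k] WeylField n k}
    (h : ∀ P : WeylAlgebra n k, f (numeratorHom P) = g (numeratorHom P)) : f = g := by
  refine AlgHom.ext fun z => ?_
  induction z using OreLocalization.ind with
  | _ P s =>
    have hs : (numeratorHom (s : WeylAlgebra n k) : WeylField n k) * (P /ₒ s)
        = numeratorHom P := by
      rw [numeratorHom_apply, numeratorHom_apply]
      exact OreLocalization.smul_cancel (r := P) (s := s) (t := 1)
    have h0 : (numeratorHom (s : WeylAlgebra n k) : WeylField n k) ≠ 0 := by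
      rw [← map_zero (numeratorRingHom (S := nonZeroDivisors (WeylAlgebra n k)))]
      exact fun hz => nonZeroDivisors.ne_zero s.2
        (numeratorHom_inj (S := nonZeroDivisors (WeylAlgebra n k)) inf_le_left hz)
    have h1 : f (numeratorHom (s : WeylAlgebra n k)) ≠ 0 := by
      rwa [ne_eq, map_eq_zero_iff f f.toRingHom.injective]
    refine mul_left_cancel₀ h1 ?_
    rw [← map_mul, hs, h, h, ← map_mul, hs]

/-- The extension of an automorphism of the Weyl algebra to the Weyl field, `s⁻¹ r ↦ φ(s)⁻¹ φ(r)`,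
as a homomorphism. -/
noncomputable def mapHom (φ : WeylAlgebra n k ≃ₐ[k] WeylAlgebra n k) :
    WeylField n k →ₐ[k] WeylField n k :=
  let f : WeylAlgebra n k →+* WeylField n k := numeratorRingHom.comp φ.toRingEquiv.toRingHom
  have hf : ∀ s : nonZeroDivisors (WeylAlgebra n k),
      IsUnit (((f : WeylAlgebra n k →* WeylField n k).comp
        (nonZeroDivisors (WeylAlgebra n k)).subtype) s) := fun s =>
    (numeratorUnit ⟨φ s, mem_nonZeroDivisors_of_ne_zero
      (by simp)⟩).isUnit
  { universalHom f (IsUnit.liftRight _ hf) (fun _ => rfl) with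
    commutes' := fun c => by
      refine (universalHom_commutes f (IsUnit.liftRight _ hf) (fun _ => rfl)).trans ?_
      exact congrArg numeratorHom (φ.commutes c) }

theorem mapHom_numerator (φ : WeylAlgebra n k ≃ₐ[k] WeylAlgebra n k)
    (P : WeylAlgebra n k) : mapHom φ (numeratorHom P) = numeratorHom (φ P) :=
  universalHom_commutes _ _ _

/-- The extension of automorphisms of the Weyl algebra to automorphisms of the Weyl field. -/
noncomputable def map :
    (WeylAlgebra n k ≃ₐ[k] WeylAlgebra n k) →* (WeylField n k ≃ₐ[k] WeylField n k) where
  toFun φ := AlgEquiv.ofAlgHom (mapHom φ) (mapHom φ.symm)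
    (algHom_ext fun P => by
      rw [AlgHom.comp_apply, mapHom_numerator, mapHom_numerator, AlgEquiv.apply_symm_apply]
      rfl)
    (algHom_ext fun P => by
      rw [AlgHom.comp_apply, mapHom_numerator, mapHom_numerator, AlgEquiv.symm_apply_apply]
      rfl)
  map_one' := AlgEquiv.coe_toAlgHom_injective (algHom_ext fun P => mapHom_numerator _ _)
  map_mul' φ ψ := AlgEquiv.coe_toAlgHom_injective (algHom_ext fun P => by
    change mapHom (φ * ψ) (numeratorHom P) = mapHom φ (mapHom ψ (numeratorHom P))
    rw [mapHom_numerator, mapHom_numerator, mapHom_numerator, AlgEquiv.mul_apply])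

end WeylField

/-! ### Linear actions -/

section LinearAction

variable {n : ℕ} {k : Type*} [Field k]

/-- The algebra homomorphism `f ↦ f ∘ A⁻¹` of the coordinate ring `k[x₁, …, xₙ]` of `kⁿ`:
`xᵢ ↦ ∑ⱼ (A⁻¹)ᵢⱼ xⱼ`. -/
noncomputable def polynomialHom (A : Matrix.GeneralLinearGroup (Fin n) k) :
    MvPolynomial (Fin n) k →ₐ[k] MvPolynomial (Fin n) k :=
  MvPolynomial.aeval fun i =>
    ∑ j, (A⁻¹ : Matrix.GeneralLinearGroup (Fin n) k).1 i j • MvPolynomial.X j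

theorem polynomialHom_one : polynomialHom (1 : Matrix.GeneralLinearGroup (Fin n) k)
    = AlgHom.id k _ := by
  refine MvPolynomial.algHom_ext fun i => ?_
  simp [polynomialHom, Matrix.one_apply]

theorem polynomialHom_mul (A B : Matrix.GeneralLinearGroup (Fin n) k) :
    polynomialHom (A * B) = (polynomialHom A).comp (polynomialHom B) := by
  refine MvPolynomial.algHom_ext fun i => ?_
  simp only [polynomialHom, MvPolynomial.aeval_X, AlgHom.comp_apply, map_sum, map_smul,
    mul_inv_rev, Units.val_mul, Matrix.mul_apply, Finset.sum_smul, Finset.smul_sum, smul_smul]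
  rw [Finset.sum_comm]

/-- The natural action of `GLₙ(k)` on `k[x₁, …, xₙ]`, `(A • f)(v) = f(A⁻¹ v)`. -/
noncomputable def polynomialAction : Matrix.GeneralLinearGroup (Fin n) k →*
    (MvPolynomial (Fin n) k ≃ₐ[k] MvPolynomial (Fin n) k) where
  toFun A := AlgEquiv.ofAlgHom (polynomialHom A) (polynomialHom A⁻¹)
    (by rw [← polynomialHom_mul, mul_inv_cancel, polynomialHom_one])
    (by rw [← polynomialHom_mul, inv_mul_cancel, polynomialHom_one])
  map_one' := AlgEquiv.coe_toAlgHom_injective polynomialHom_one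
  map_mul' A B := AlgEquiv.coe_toAlgHom_injective (polynomialHom_mul A B)

theorem sum_smul_mul_sum_smul {B : Type*} [Ring B] [Algebra k B] (a b : Fin n → k)
    (u v : Fin n → B) : (∑ j, a j • u j) * (∑ l, b l • v l)
      = ∑ j, ∑ l, (a j * b l) • (u j * v l) := by
  simp only [Finset.sum_mul_sum, smul_mul_smul_comm]

/-- The endomorphism of the Weyl algebra extending `polynomialHom A`. On differential operators it
is the conjugation `D ↦ A ∘ D ∘ A⁻¹`, so that `∂ᵢ ↦ ∑ⱼ Aⱼᵢ ∂ⱼ`. -/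
noncomputable def weylHom (A : Matrix.GeneralLinearGroup (Fin n) k) :
    WeylAlgebra n k →ₐ[k] WeylAlgebra n k :=
  WeylAlgebra.lift
    (fun i => ∑ j, (A⁻¹ : Matrix.GeneralLinearGroup (Fin n) k).1 i j • WeylAlgebra.x k j)
    (fun i => ∑ j, A.1 j i • WeylAlgebra.d k j)
    (fun i j => by
      rw [sum_smul_mul_sum_smul, sum_smul_mul_sum_smul, Finset.sum_comm]
      refine Finset.sum_congr rfl fun p _ => Finset.sum_congr rfl fun q _ => ?_
      rw [mul_comm, WeylAlgebra.x_mul_x])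
    (fun i j => by
      rw [sum_smul_mul_sum_smul, sum_smul_mul_sum_smul, Finset.sum_comm]
      refine Finset.sum_congr rfl fun p _ => Finset.sum_congr rfl fun q _ => ?_
      rw [mul_comm, WeylAlgebra.d_mul_d])
    (fun i j => by
      rw [sum_smul_mul_sum_smul, sum_smul_mul_sum_smul, Finset.sum_comm, ← Finset.sum_sub_distrib]
      have h : ∀ p q : Fin n,
          (A.1 q i * (A⁻¹ : Matrix.GeneralLinearGroup (Fin n) k).1 j p) •
            (WeylAlgebra.d k q * WeylAlgebra.x k p)
          - ((A⁻¹ : Matrix.GeneralLinearGroup (Fin n) k).1 j p * A.1 q i) •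
            (WeylAlgebra.x k p * WeylAlgebra.d k q)
          = if q = p then ((A⁻¹ : Matrix.GeneralLinearGroup (Fin n) k).1 j p * A.1 q i) •
            (1 : WeylAlgebra n k) else 0 := fun p q => by
        rw [mul_comm (A.1 q i), ← smul_sub, WeylAlgebra.d_mul_x_sub]
        split_ifs <;> simp
      simp only [← Finset.sum_sub_distrib, h, Finset.sum_ite_eq', Finset.mem_univ, if_true]
      rw [← Finset.sum_smul, ← Matrix.mul_apply, ← Units.val_mul, inv_mul_cancel, Units.val_one,
        Matrix.one_apply]
      by_cases hij : i = j
      · simp [hij]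
      · simp [hij, Ne.symm hij])

theorem weylHom_one : weylHom (1 : Matrix.GeneralLinearGroup (Fin n) k) = AlgHom.id k _ := by
  refine WeylAlgebra.algHom_ext (fun i => ?_) (fun i => ?_) <;>
  simp [weylHom, Matrix.one_apply]

theorem weylHom_mul (A B : Matrix.GeneralLinearGroup (Fin n) k) :
    weylHom (A * B) = (weylHom A).comp (weylHom B) := by
  refine WeylAlgebra.algHom_ext (fun i => ?_) (fun i => ?_)
  · simp only [weylHom, WeylAlgebra.lift_x, AlgHom.comp_apply, map_sum, map_smul,
      mul_inv_rev, Units.val_mul, Matrix.mul_apply, Finset.sum_smul, Finset.smul_sum, smul_smul]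
    rw [Finset.sum_comm]
  · simp only [weylHom, WeylAlgebra.lift_d, AlgHom.comp_apply, map_sum, map_smul,
      Units.val_mul, Matrix.mul_apply, Finset.sum_smul, Finset.smul_sum, smul_smul]
    rw [Finset.sum_comm]
    simp only [mul_comm]

/-- The action of `GLₙ(k)` on the Weyl algebra extending the one on `k[x₁, …, xₙ]`. -/
noncomputable def weylAction : Matrix.GeneralLinearGroup (Fin n) k →*
    (WeylAlgebra n k ≃ₐ[k] WeylAlgebra n k) where
  toFun A := AlgEquiv.ofAlgHom (weylHom A) (weylHom A⁻¹)
    (by rw [← weylHom_mul, mul_inv_cancel, weylHom_one])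
    (by rw [← weylHom_mul, inv_mul_cancel, weylHom_one])
  map_one' := AlgEquiv.coe_toAlgHom_injective weylHom_one
  map_mul' A B := AlgEquiv.coe_toAlgHom_injective (weylHom_mul A B)

/-- The subalgebra of invariants of a group acting by algebra automorphisms. -/
def invariants {G B : Type*} [Group G] [Semiring B] [Algebra k B] (φ : G →* (B ≃ₐ[k] B)) :
    Subalgebra k B where
  carrier := {b | ∀ g, φ g b = b}
  mul_mem' ha hb g := by rw [map_mul, ha g, hb g]
  add_mem' ha hb g := by rw [map_add, ha g, hb g]
  algebraMap_mem' c g := (φ g).commutes c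

/-- For a linear action `ρ` of `G` on `kⁿ`, the ring of invariants `k[x₁, …, xₙ]^G`, that is, the
coordinate ring of the quotient variety `𝔸ⁿ(k)/G`. -/
noncomputable abbrev polynomialInvariants {G : Type*} [Group G]
    (ρ : G →* Matrix.GeneralLinearGroup (Fin n) k) : Subalgebra k (MvPolynomial (Fin n) k) :=
  invariants (polynomialAction.comp ρ)

/-- For a linear action `ρ` of `G` on `kⁿ`, the skew field of invariants `Fₙ(k)^G`. -/
noncomputable abbrev weylFieldInvariants {G : Type*} [Group G]
    (ρ : G →* Matrix.GeneralLinearGroup (Fin n) k) : Subalgebra k (WeylField n k) :=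
  invariants (WeylField.map.comp (weylAction.comp ρ))

end LinearAction

/-- An irreducible affine variety over `k` with coordinate ring `R` is rational if it is birational
to an affine space: its field of rational functions is isomorphic over `k` to `k(t₁, …, tₘ)` for
some `m`. -/
def IsRationalVariety (k R : Type*) [Field k] [CommRing R] [IsDomain R] [Algebra k R] : Prop :=
  ∃ m : ℕ, Nonempty (FractionRing R ≃ₐ[k] FractionRing (MvPolynomial (Fin m) k))

/-!
Let `K = k(x₁, …, xₙ)`. A rational quotient provides invariant `y₁, …, yₘ` in `K` which generate
`L = Frac k[x₁, …, xₙ]^G` freely, and `m = n` since `K` is algebraic over `L`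
(`exists_generators_of_isRationalVariety`). As `K / L` is separable, the derivations `∂/∂yᵢ` of `L`
extend uniquely to `K`. By uniqueness they commute with each other and with `G`. Every derivation `D`
of `K` is the element `∑ⱼ D(xⱼ) ∂ⱼ` of the Weyl field `Fₙ(k)` (`WeylField.ofDer`), so the `yᵢ` and
`∂/∂yᵢ` are elements of `Fₙ(k)^G` which satisfy the Weyl relations. The Weyl algebra is simple in
characteristic zero (`WeylAlgebra.algHom_injective`), so they define an embedding of `Fₙ(k)` in
`Fₙ(k)^G`. Let `E` be its image.

It remains to see that `E` contains every invariant. The left `E`-subspace of `Fₙ(k)` spanned by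
`k[x₁, …, xₙ]` is finite-dimensional, because `k[x₁, …, xₙ]` is a finite module over its invariants,
which lie in `E`. The span contains `K` and is stable under right multiplication by the `xᵢ` and by
`∂ⱼ = ∑ᵢ (∂yᵢ/∂xⱼ) ∂/∂yᵢ`, hence by the Weyl algebra and, by finite-dimensionality, by the inverses
of its nonzero elements. So it is all of `Fₙ(k)` (`WeylField.polySpan_eq_top`). If an invariant is
written as `∑ eᵢ pᵢ` with `eᵢ` in `E` and polynomials `pᵢ`, then averaging over `G` replaces the `pᵢ`
by invariant polynomials, which lie in `E` (`WeylField.mem_of_mem_weylFieldInvariants`).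
-/

/-! ### Derivations along formally étale maps -/

section Derivations

open MvPolynomial TensorProduct

/-- Derivations extend uniquely along a formally étale map `A → K`, because `K ⊗ Ω[A/k] ≃ Ω[K/k]`. -/
theorem Derivation.existsUnique_extension_of_formallyEtale {k A K : Type*} [CommRing k]
    [CommRing A] [CommRing K] [Algebra k A] [Algebra k K] [Algebra A K] [IsScalarTower k A K]
    [Algebra.FormallyEtale A K] (d : Derivation k A K) :
    ∃! D : Derivation k K K, ∀ a, D (algebraMap A K a) = d a := by
  have h (a : A) := KaehlerDifferential.tensorKaehlerEquivOfFormallyEtale_symm_D_algebraMap k A K a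
  refine ⟨((LinearMap.liftBaseChange K d.liftKaehlerDifferential).comp
    (KaehlerDifferential.tensorKaehlerEquivOfFormallyEtale k A K).symm.toLinearMap).compDer
      (KaehlerDifferential.D k K), fun a => ?_, fun D hD => ?_⟩
  · change LinearMap.liftBaseChange K d.liftKaehlerDifferential
      ((KaehlerDifferential.tensorKaehlerEquivOfFormallyEtale k A K).symm
        (KaehlerDifferential.D k K (algebraMap _ K a))) = _
    rw [h, LinearMap.liftBaseChange_tmul, one_smul, Derivation.liftKaehlerDifferential_comp_D]
  · suffices hl : D.liftKaehlerDifferential =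
        (LinearMap.liftBaseChange K d.liftKaehlerDifferential).comp
          (KaehlerDifferential.tensorKaehlerEquivOfFormallyEtale k A K).symm.toLinearMap by
      rw [← hl]
      ext b
      simp
    rw [LinearEquiv.eq_comp_toLinearMap_symm]
    refine (LinearMap.liftBaseChangeEquiv K).symm.injective
      (Derivation.liftKaehlerDifferential_unique _ _ (Derivation.ext fun a => ?_))
    have h' : KaehlerDifferential.tensorKaehlerEquivOfFormallyEtale k A K
        (1 ⊗ₜ[A] KaehlerDifferential.D k A a) = KaehlerDifferential.D k K (algebraMap A K a) := by
      rw [← h, LinearEquiv.apply_symm_apply]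
    change D.liftKaehlerDifferential (KaehlerDifferential.tensorKaehlerEquivOfFormallyEtale k A K
        (1 ⊗ₜ[A] KaehlerDifferential.D k A a)) =
      (1 : K) • d.liftKaehlerDifferential (KaehlerDifferential.D k A a)
    rw [h', one_smul, Derivation.liftKaehlerDifferential_comp_D,
      Derivation.liftKaehlerDifferential_comp_D, hD]

variable {k K : Type*} [Field k] [Field K] [Algebra k K] {σ : Type*}

/-- If `K` is formally étale over a polynomial ring with coordinates `yⱼ = φ (X j)`, the partial
derivatives `∂/∂yᵢ` exist as derivations of `K`. -/
theorem exists_dual_derivations [DecidableEq σ] (φ : MvPolynomial σ k →ₐ[k] K)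
    (hφ : φ.toRingHom.FormallyEtale) :
    ∃ D : σ → Derivation k K K, ∀ i j, D i (φ (X j)) = if i = j then 1 else 0 := by
  let : Algebra (MvPolynomial σ k) K := φ.toRingHom.toAlgebra
  have : IsScalarTower k (MvPolynomial σ k) K := .of_algebraMap_eq' φ.comp_algebraMap.symm
  have : Algebra.FormallyEtale (MvPolynomial σ k) K := hφ
  choose D hD _ using fun i : σ => Derivation.existsUnique_extension_of_formallyEtale (K := K)
    (mkDerivation k fun j => if i = j then (1 : K) else 0)
  exact ⟨D, fun i j => (hD i (X j)).trans (by rw [mkDerivation_X])⟩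

theorem derivation_eq_of_formallyEtale (φ : MvPolynomial σ k →ₐ[k] K)
    (hφ : φ.toRingHom.FormallyEtale) {D D' : Derivation k K K}
    (h : ∀ j, D (φ (X j)) = D' (φ (X j))) : D = D' := by
  let : Algebra (MvPolynomial σ k) K := φ.toRingHom.toAlgebra
  have : IsScalarTower k (MvPolynomial σ k) K := .of_algebraMap_eq' φ.comp_algebraMap.symm
  have : Algebra.FormallyEtale (MvPolynomial σ k) K := hφ
  have h1 : D.compAlgebraMap (MvPolynomial σ k) = D'.compAlgebraMap (MvPolynomial σ k) :=
    derivation_ext h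
  exact (Derivation.existsUnique_extension_of_formallyEtale
    (D'.compAlgebraMap (MvPolynomial σ k))).unique (fun a => DFunLike.congr_fun h1 a)
      (fun a => rfl)

/-- An automorphism fixing the coordinates `yⱼ` commutes with every derivation whose values on the
`yⱼ` it fixes. -/
theorem derivation_commute_of_formallyEtale (φ : MvPolynomial σ k →ₐ[k] K)
    (hφ : φ.toRingHom.FormallyEtale) (τ : K ≃ₐ[k] K) {D : Derivation k K K}
    (hτ : ∀ j, τ (φ (X j)) = φ (X j)) (hD : ∀ j, τ (D (φ (X j))) = D (φ (X j))) (a : K) :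
    τ (D a) = D (τ a) := by
  let D' : Derivation k K K := Derivation.mk'
    (τ.symm.toLinearMap.comp (D.toLinearMap.comp τ.toLinearMap)) fun a b => by
      change τ.symm (D (τ (a * b))) = a • τ.symm (D (τ b)) + b • τ.symm (D (τ a))
      simp only [map_mul, Derivation.leibniz, smul_eq_mul, map_add, AlgEquiv.symm_apply_apply]
  have h : D' = D := derivation_eq_of_formallyEtale φ hφ fun j => by
    change τ.symm (D (τ (φ (X j)))) = _
    rw [hτ, AlgEquiv.symm_apply_eq, hD]
  have ha : τ.symm (D (τ a)) = D a := DFunLike.congr_fun h a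
  rw [← ha, AlgEquiv.apply_symm_apply]

end Derivations

/-! ### The Weyl field and its subfield of rational functions -/

section Embeddings

open OreLocalization MvPolynomial

/-- An injective homomorphism from an Ore domain to a division ring extends to the skew field of
fractions. -/
theorem OreLocalization.exists_extension {R T : Type*} [Ring R] [Nontrivial R] [NoZeroDivisors R]
    [OreSet (nonZeroDivisors R)] [DivisionRing T] (f : R →+* T) (hf : Function.Injective f) :
    ∃ F : OreLocalization (nonZeroDivisors R) R →+* T, ∀ r, F (numeratorHom r) = f r := by
  have h (s : nonZeroDivisors R) :
      IsUnit (((f : R →* T).comp (nonZeroDivisors R).subtype) s) :=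
    isUnit_iff_ne_zero.mpr ((map_ne_zero_iff f hf).mpr (nonZeroDivisors.ne_zero s.2))
  exact ⟨universalHom f (IsUnit.liftRight _ h) fun _ => rfl, fun r => universalHom_commutes _ _ _⟩

variable {n : ℕ} {k : Type*} [Field k]

namespace WeylAlgebra

/-- In the representation `rep`, polynomials in the `xᵢ` act by multiplication. -/
theorem rep_evalX (p : MvPolynomial (Fin n) k) (f : MvPolynomial (Fin n ⊕ Fin n) k) :
    rep (evalX p) f = rename Sum.inl p * f := by
  induction p using MvPolynomial.induction_on generalizing f with
  | C c =>
    rw [← MvPolynomial.algebraMap_eq, AlgHom.commutes, AlgHom.commutes, AlgHom.commutes,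
      Module.algebraMap_end_apply, Algebra.smul_def]
  | add p q hp hq => rw [map_add, map_add, LinearMap.add_apply, hp, hq, map_add, add_mul]
  | mul_X p i hp =>
    rw [map_mul, map_mul, Module.End.mul_apply, evalX_X, rep_x, hp, map_mul, rename_X, mul_assoc]

theorem evalX_injective : Function.Injective (evalX (n := n) (k := k)) := fun p q h => by
  have := congrArg (fun P => rep P 1) h
  simp only [rep_evalX, mul_one] at this
  exact rename_injective _ Sum.inl_injective this

end WeylAlgebra

namespace WeylField

variable (n k) in
/-- The inclusion of the Weyl algebra in the Weyl field. -/
noncomputable def ofWeyl : WeylAlgebra n k →ₐ[k] WeylField n k :=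
  { numeratorRingHom with commutes' := fun _ => rfl }

theorem ofWeyl_injective : Function.Injective (ofWeyl n k) :=
  numeratorHom_inj (S := nonZeroDivisors (WeylAlgebra n k)) inf_le_left

theorem ofWeyl_ne_zero {P : WeylAlgebra n k} (hP : P ≠ 0) : ofWeyl n k P ≠ 0 :=
  (map_ne_zero_iff _ ofWeyl_injective).mpr hP

/-- Every element of the Weyl field is a left fraction `S⁻¹ P`. -/
theorem exists_ofWeyl_mul_eq (z : WeylField n k) :
    ∃ P S : WeylAlgebra n k, S ≠ 0 ∧ ofWeyl n k S * z = ofWeyl n k P := by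
  induction z using OreLocalization.ind with
  | _ P s =>
    refine ⟨P, s, nonZeroDivisors.ne_zero s.2, ?_⟩
    change numeratorHom (s : WeylAlgebra n k) * (P /ₒ s) = numeratorHom P
    rw [numeratorHom_apply, numeratorHom_apply]
    exact OreLocalization.smul_cancel (r := P) (s := s) (t := 1)

theorem exists_extension {T : Type*} [DivisionRing T] [Algebra k T] (f : WeylAlgebra n k →ₐ[k] T)
    (hf : Function.Injective f) :
    ∃ F : WeylField n k →ₐ[k] T, ∀ P, F (ofWeyl n k P) = f P := by
  obtain ⟨F, hF⟩ := OreLocalization.exists_extension (f : WeylAlgebra n k →+* T) hf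
  exact ⟨{ F with commutes' := fun c => (hF _).trans (f.commutes c) }, hF⟩

variable (n k) in
theorem exists_fractionRing_hom : ∃ ι : FractionRing (MvPolynomial (Fin n) k) →ₐ[k] WeylField n k,
    ∀ p : MvPolynomial (Fin n) k, ι (algebraMap _ _ p) = ofWeyl n k (WeylAlgebra.evalX p) := by
  obtain ⟨F, hF⟩ := OreLocalization.exists_extension
    ((ofWeyl n k).comp WeylAlgebra.evalX : MvPolynomial (Fin n) k →+* WeylField n k)
    (ofWeyl_injective.comp WeylAlgebra.evalX_injective)
  have hF' : ∀ p, F (algebraMap _ (FractionRing (MvPolynomial (Fin n) k)) p)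
      = ofWeyl n k (WeylAlgebra.evalX p) := hF
  refine ⟨{ F with commutes' := fun c => ?_ }, hF'⟩
  refine (congrArg F (IsScalarTower.algebraMap_apply k (MvPolynomial (Fin n) k)
    (FractionRing (MvPolynomial (Fin n) k)) c)).trans ((hF' _).trans ?_)
  rw [AlgHom.commutes, AlgHom.commutes]

variable (n k) in
/-- The inclusion of `k(x₁, …, xₙ)` in the Weyl field, extending `evalX`. The universal property of
commutative localizations does not apply to a noncommutative target, so the map is obtained from the
one of Ore localizations. -/
noncomputable def ofFrac : FractionRing (MvPolynomial (Fin n) k) →ₐ[k] WeylField n k :=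
  (exists_fractionRing_hom n k).choose

theorem ofFrac_algebraMap (p : MvPolynomial (Fin n) k) :
    ofFrac n k (algebraMap _ _ p) = ofWeyl n k (WeylAlgebra.evalX p) :=
  (exists_fractionRing_hom n k).choose_spec p

theorem ofFrac_mul_comm (a b : FractionRing (MvPolynomial (Fin n) k)) :
    ofFrac n k a * ofFrac n k b = ofFrac n k b * ofFrac n k a := by
  rw [← map_mul, mul_comm, map_mul]

theorem map_ofWeyl (φ : WeylAlgebra n k ≃ₐ[k] WeylAlgebra n k) (P : WeylAlgebra n k) :
    map φ (ofWeyl n k P) = ofWeyl n k (φ P) :=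
  mapHom_numerator φ P

/-- If `[δ, p] = D p` for all polynomials `p`, then `[δ, a] = D a` for all rational functions `a`. -/
theorem mul_ofFrac_of_polynomial (δ : WeylField n k)
    (D : Derivation k (FractionRing (MvPolynomial (Fin n) k))
      (FractionRing (MvPolynomial (Fin n) k)))
    (h : ∀ p : MvPolynomial (Fin n) k, δ * ofFrac n k (algebraMap _ _ p)
      = ofFrac n k (algebraMap _ _ p) * δ + ofFrac n k (D (algebraMap _ _ p)))
    (a : FractionRing (MvPolynomial (Fin n) k)) :
    δ * ofFrac n k a = ofFrac n k a * δ + ofFrac n k (D a) := by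
  obtain ⟨p, q, hq, rfl⟩ := IsFractionRing.div_surjective (A := MvPolynomial (Fin n) k) a
  have hq0 : algebraMap _ (FractionRing (MvPolynomial (Fin n) k)) q ≠ 0 :=
    IsFractionRing.to_map_ne_zero_of_mem_nonZeroDivisors hq
  generalize hP : algebraMap _ (FractionRing (MvPolynomial (Fin n) k)) p = P
  generalize hQ : algebraMap _ (FractionRing (MvPolynomial (Fin n) k)) q = Q at hq0
  have h1 := hP ▸ h p
  have h2 := hQ ▸ h q
  -- Apply `D` and `[δ, ·]` to `P = (P / Q) * Q` and cancel `Q` on the right.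
  have h3 : P / Q * Q = P := div_mul_cancel₀ _ hq0
  have h4 : D P = P / Q * D Q + Q * D (P / Q) := by
    conv_lhs => rw [← h3]
    rw [Derivation.leibniz, smul_eq_mul, smul_eq_mul]
  have hQ0 : ofFrac n k Q ≠ 0 := (map_ne_zero_iff _ (ofFrac n k).toRingHom.injective).mpr hq0
  refine mul_right_cancel₀ hQ0 ?_
  have h5 : ofFrac n k (P / Q) * ofFrac n k Q = ofFrac n k P := by rw [← map_mul, h3]
  rw [mul_assoc, h5, h1, add_mul, h4, map_add, map_mul, map_mul, ofFrac_mul_comm Q, mul_assoc,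
    ← add_assoc, ← h5, mul_assoc, ← mul_add, h2]

end WeylField

end Embeddings

/-! ### Derivations of the function field inside the Weyl field -/

section VectorFields

open MvPolynomial WeylField

variable {n : ℕ} {k : Type*} [Field k]

theorem MvPolynomial.derivation_apply_eq_sum {σ M : Type*} [Fintype σ] [AddCommGroup M]
    [Module k M] [Module (MvPolynomial σ k) M] [IsScalarTower k (MvPolynomial σ k) M]
    (D : Derivation k (MvPolynomial σ k) M) (p : MvPolynomial σ k) :
    D p = ∑ j, pderiv j p • D (X j) := by
  classical
  induction p using MvPolynomial.induction_on with
  | C c => simp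
  | add p q hp hq => simp only [map_add, hp, hq, add_smul, Finset.sum_add_distrib]
  | mul_X p i hp =>
    simp only [Derivation.leibniz, hp, add_smul, Finset.sum_add_distrib, Finset.smul_sum,
      smul_assoc, pderiv_X]
    simp [Pi.single_apply, ite_smul]

namespace WeylField

/-- The derivation `D` of `k(x₁, …, xₙ)` as an element of the Weyl field, namely the vector field
`∑ⱼ D(xⱼ) ∂ⱼ`. -/
noncomputable def ofDer (D : Derivation k (FractionRing (MvPolynomial (Fin n) k))
    (FractionRing (MvPolynomial (Fin n) k))) : WeylField n k :=
  ∑ j, ofFrac n k (D (algebraMap (MvPolynomial (Fin n) k) _ (X j))) * ofWeyl n k (WeylAlgebra.d k j)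

variable (D D' : Derivation k (FractionRing (MvPolynomial (Fin n) k))
    (FractionRing (MvPolynomial (Fin n) k)))

/-- The commutator of a vector field with a function `a` is the function `D a`. -/
theorem ofDer_mul_ofFrac (a : FractionRing (MvPolynomial (Fin n) k)) :
    ofDer D * ofFrac n k a = ofFrac n k a * ofDer D + ofFrac n k (D a) := by
  refine mul_ofFrac_of_polynomial _ D (fun p => ?_) a
  have h : D (algebraMap (MvPolynomial (Fin n) k) _ p) = ∑ j, algebraMap _ _ (pderiv j p) *
      D (algebraMap (MvPolynomial (Fin n) k) _ (X j)) := by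
    have := MvPolynomial.derivation_apply_eq_sum (D.compAlgebraMap (MvPolynomial (Fin n) k)) p
    simpa [Algebra.smul_def] using this
  rw [h, ofDer, Finset.sum_mul, Finset.mul_sum, map_sum, ← Finset.sum_add_distrib]
  refine Finset.sum_congr rfl fun j _ => ?_
  rw [mul_assoc, map_mul, ofFrac_mul_comm _ (D _), ofFrac_algebraMap p,
    ofFrac_algebraMap (pderiv j p), ← map_mul, WeylAlgebra.d_mul_evalX, map_add, map_mul, mul_add,
    ← mul_assoc, ← ofFrac_algebraMap p, ofFrac_mul_comm (D _), mul_assoc]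

/-- Commuting derivations give commuting elements of the Weyl field. -/
theorem ofDer_mul_ofDer_comm (h : ∀ a, D (D' a) = D' (D a)) :
    ofDer D * ofDer D' = ofDer D' * ofDer D := by
  -- In the normal form of the product, the second order part is symmetric in `D` and `D'`, and the
  -- first order part is `D ∘ D'`.
  have key (D D' : Derivation k (FractionRing (MvPolynomial (Fin n) k))
      (FractionRing (MvPolynomial (Fin n) k))) : ofDer D * ofDer D' =
      (∑ m, ∑ l, ofFrac n k (D' (algebraMap (MvPolynomial (Fin n) k) _ (X m)) *
          D (algebraMap (MvPolynomial (Fin n) k) _ (X l))) *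
        (ofWeyl n k (WeylAlgebra.d k l * WeylAlgebra.d k m))) +
      ∑ m, ofFrac n k (D (D' (algebraMap (MvPolynomial (Fin n) k) _ (X m)))) *
        ofWeyl n k (WeylAlgebra.d k m) := by
    conv_lhs => rw [ofDer.eq_1 D', Finset.mul_sum]
    rw [← Finset.sum_add_distrib]
    refine Finset.sum_congr rfl fun m _ => ?_
    rw [← mul_assoc, ofDer_mul_ofFrac, add_mul, ofDer, Finset.mul_sum, Finset.sum_mul]
    simp only [map_mul, mul_assoc]
  rw [key, key D' D, Finset.sum_comm]
  simp only [h, mul_comm (D' _) (D _), WeylAlgebra.d_mul_d]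

/-- A linear substitution fixes the vector field of `D` in the Weyl field as soon as its action `τ` on
`k(x₁, …, xₙ)` commutes with `D`: the coefficients of `∑ⱼ D(xⱼ) ∂ⱼ` and the `∂ⱼ` transform
contragrediently. -/
theorem map_weylAction_ofDer (A : Matrix.GeneralLinearGroup (Fin n) k)
    (τ : FractionRing (MvPolynomial (Fin n) k) →ₐ[k] FractionRing (MvPolynomial (Fin n) k))
    (hτ : ∀ a, map (weylAction A) (ofFrac n k a) = ofFrac n k (τ a))
    (hD : ∀ a, τ (D a) = D (τ a)) (hX : ∀ i, τ (algebraMap (MvPolynomial (Fin n) k) _ (X i)) =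
      ∑ j, (A⁻¹ : Matrix.GeneralLinearGroup (Fin n) k).1 i j •
        algebraMap (MvPolynomial (Fin n) k) _ (X j)) :
    map (weylAction A) (ofDer D) = ofDer D := by
  have hd (j : Fin n) : weylAction A (WeylAlgebra.d k j) = ∑ l, A.1 l j • WeylAlgebra.d k l :=
    WeylAlgebra.lift_d ..
  have h (m l : Fin n) : ∑ j, (A⁻¹ : Matrix.GeneralLinearGroup (Fin n) k).1 j m * A.1 l j
      = if l = m then 1 else 0 := by
    simp only [mul_comm ((A⁻¹ : Matrix.GeneralLinearGroup (Fin n) k).1 _ _)]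
    rw [← Matrix.mul_apply, ← Units.val_mul, mul_inv_cancel, Units.val_one, Matrix.one_apply]
  have h' (j : Fin n) : map (weylAction A) (ofFrac n k (D (algebraMap (MvPolynomial (Fin n) k) _
        (X j))) * ofWeyl n k (WeylAlgebra.d k j)) =
      ∑ m, ∑ l, ((A⁻¹ : Matrix.GeneralLinearGroup (Fin n) k).1 j m * A.1 l j) •
        (ofFrac n k (D (algebraMap (MvPolynomial (Fin n) k) _ (X m))) *
          ofWeyl n k (WeylAlgebra.d k l)) := by
    rw [map_mul, hτ, hD, hX, map_ofWeyl, hd, map_sum, map_sum, map_sum, ← sum_smul_mul_sum_smul]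
    simp only [Derivation.map_smul, map_smul]
  rw [ofDer, map_sum, Finset.sum_congr rfl fun j _ => h' j, Finset.sum_comm]
  refine Finset.sum_congr rfl fun m _ => ?_
  rw [Finset.sum_comm]
  simp only [← Finset.sum_smul, h, ite_smul, one_smul, zero_smul, Finset.sum_ite_eq',
    Finset.mem_univ, if_true]

end WeylField

end VectorFields

/-! ### Simplicity of the Weyl algebra -/

section Simplicity

open MvPolynomial

variable {n : ℕ} {k : Type*} [Field k]

theorem MvPolynomial.eq_C_of_pderiv_eq_zero {σ : Type*} [CharZero k] {f : MvPolynomial σ k}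
    (h : ∀ i, pderiv i f = 0) : f = C (coeff 0 f) := by
  classical
  ext s
  rw [coeff_C]
  split_ifs with hs
  · rw [hs]
  · obtain ⟨i, hi⟩ : ∃ i, s i ≠ 0 := by
      by_contra! hcon
      exact hs (Finsupp.ext hcon).symm
    have h1 : s - Finsupp.single i 1 + Finsupp.single i 1 = s :=
      tsub_add_cancel_of_le (by simpa [Nat.one_le_iff_ne_zero] using hi)
    have h2 := congrArg (coeff (s - Finsupp.single i 1)) (h i)
    rw [coeff_pderiv, h1, coeff_zero, mul_eq_zero] at h2
    exact h2.resolve_right (Nat.cast_add_one_ne_zero _)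

namespace WeylAlgebra

theorem evalD_mul_x (i : Fin n) (p : MvPolynomial (Fin n) k) :
    evalD p * x k i = x k i * evalD p + evalD (pderiv i p) := by
  induction p using MvPolynomial.induction_on with
  | C c =>
    rw [pderiv_C, map_zero, add_zero, ← MvPolynomial.algebraMap_eq, AlgHom.commutes,
      Algebra.commutes]
  | add p q hp hq => simp only [map_add, mul_add, add_mul, hp, hq]; abel
  | mul_X p j hp =>
    have h := sub_eq_iff_eq_add.mp (d_mul_x_sub (k := k) j i)
    rw [Derivation.leibniz, map_mul, map_add, smul_eq_mul, smul_eq_mul, evalD_X, mul_assoc, h,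
      mul_add, ← mul_assoc, hp, add_mul, mul_comm (X j), map_mul _ _ (X j), evalD_X, map_mul,
      pderiv_X]
    by_cases hij : i = j
    · subst hij; simp [mul_assoc]; abel
    · simp [Ne.symm hij, mul_assoc]

theorem normalOrder_mul_d (i : Fin n) (f : MvPolynomial (Fin n ⊕ Fin n) k) :
    normalOrder f * d k i = normalOrder (X (Sum.inr i) * f) := by
  suffices h : (LinearMap.mulRight k (d k i)).comp normalOrder
      = normalOrder.comp (LinearMap.mulLeft k (X (Sum.inr i))) from DFunLike.congr_fun h f
  refine monomial_ext_aux fun s => ?_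
  simp only [LinearMap.comp_apply, LinearMap.mulLeft_apply, LinearMap.mulRight_apply]
  have h1 : (X (Sum.inr i) : MvPolynomial (Fin n ⊕ Fin n) k) * monomial s 1
      = monomial (s + Finsupp.single (Sum.inr i) 1) 1 := by
    rw [X, monomial_mul, one_mul, add_comm]
  have h2 : (monomial ((Finsupp.sumFinsuppAddEquivProdFinsupp s).2 + Finsupp.single i 1) (1 : k))
      = monomial (Finsupp.sumFinsuppAddEquivProdFinsupp s).2 1 * X i := by
    rw [X, monomial_mul, one_mul]
  rw [h1, normalOrder_monomial, normalOrder_monomial, map_add, sumFinsupp_inr]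
  simp only [Prod.fst_add, Prod.snd_add, add_zero]
  rw [h2, map_mul, evalD_X, mul_assoc]

/-- Commutation with `∂ᵢ` is the partial derivative `∂/∂xᵢ` of the normally ordered symbol. -/
theorem d_mul_normalOrder_sub (i : Fin n) (f : MvPolynomial (Fin n ⊕ Fin n) k) :
    d k i * normalOrder f - normalOrder f * d k i = normalOrder (pderiv (Sum.inl i) f) := by
  rw [d_mul_normalOrder, normalOrder_mul_d, map_add, add_sub_cancel_left]

/-- Commutation with `xᵢ` is the partial derivative `∂/∂ξᵢ` of the normally ordered symbol. -/
theorem normalOrder_mul_x_sub (i : Fin n) (f : MvPolynomial (Fin n ⊕ Fin n) k) :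
    normalOrder f * x k i - x k i * normalOrder f = normalOrder (pderiv (Sum.inr i) f) := by
  suffices h : (LinearMap.mulRight k (x k i)).comp normalOrder -
      (LinearMap.mulLeft k (x k i)).comp normalOrder
      = normalOrder.comp (pderiv (Sum.inr i)).toLinearMap from DFunLike.congr_fun h f
  refine monomial_ext_aux fun s => ?_
  simp only [LinearMap.comp_apply, LinearMap.mulLeft_apply, LinearMap.mulRight_apply,
    LinearMap.sub_apply, Derivation.coeFn_coe]
  have e : ∀ {τ : Type} (t : τ →₀ ℕ) (c : k), monomial t c = c • monomial t (1 : k) :=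
    fun t c => by rw [smul_monomial, smul_eq_mul, mul_one]
  have hs : Finsupp.sumFinsuppAddEquivProdFinsupp (s - Finsupp.single (Sum.inr i) 1)
      = ((Finsupp.sumFinsuppAddEquivProdFinsupp s).1,
        (Finsupp.sumFinsuppAddEquivProdFinsupp s).2 - Finsupp.single i 1) := by
    classical
    ext j <;> simp [Finsupp.single_apply]
  have hp : evalD (pderiv i (monomial (Finsupp.sumFinsuppAddEquivProdFinsupp s).2 (1 : k))) =
      (s (Sum.inr i) : k) •
        evalD (monomial ((Finsupp.sumFinsuppAddEquivProdFinsupp s).2 - Finsupp.single i 1) 1) := by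
    rw [pderiv_monomial, one_mul, Finsupp.snd_sumFinsuppAddEquivProdFinsupp, e, map_smul]
  have hx : evalX (monomial (Finsupp.sumFinsuppAddEquivProdFinsupp s).1 (1 : k)) * x k i
      = x k i * evalX (monomial (Finsupp.sumFinsuppAddEquivProdFinsupp s).1 1) := by
    rw [← evalX_X, ← map_mul, mul_comm, map_mul]
  rw [normalOrder_monomial, mul_assoc, evalD_mul_x, mul_add, ← mul_assoc, hx, mul_assoc,
    add_sub_cancel_left, hp, pderiv_monomial, one_mul, e _ (s (Sum.inr i) : k), map_smul,
    normalOrder_monomial, hs, mul_smul_comm]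

/-- In characteristic zero, homomorphisms out of the Weyl algebra to nontrivial algebras are
injective, that is, the Weyl algebra is simple. The kernel is stable under commutators, which act on
symbols as partial derivatives; so a nonzero element of least degree in it would be a constant. -/
theorem algHom_injective [CharZero k] {B : Type*} [Ring B] [Nontrivial B] [Algebra k B]
    (φ : WeylAlgebra n k →ₐ[k] B) : Function.Injective φ := by
  have key : ∀ N, ∀ f ∈ degLT n k N, φ (normalOrder f) = 0 → f = 0 := by
    intro N
    induction N with
    | zero =>
      intro f hf _
      by_contra hne
      exact absurd (totalDegree_lt_of_mem hne hf) (by omega)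
    | succ N ih =>
      intro f hf h0
      have hd : ∀ j, pderiv j f = 0 := fun j => by
        refine ih _ (pderiv_mem_degLT j hf) ?_
        rcases j with i | i
        · rw [← d_mul_normalOrder_sub, map_sub, map_mul, map_mul, h0]; simp
        · rw [← normalOrder_mul_x_sub, map_sub, map_mul, map_mul, h0]; simp
      have hC := MvPolynomial.eq_C_of_pderiv_eq_zero hd
      rw [hC, C_eq_smul_one, map_smul, normalOrder_one, map_smul, map_one,
        smul_eq_zero] at h0
      rw [hC, h0.resolve_right one_ne_zero, C_0]
  rw [injective_iff_map_eq_zero]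
  intro P hP
  rw [← normalOrder_rep_one P] at hP ⊢
  rw [key _ _ (mem_degLT_of_totalDegree le_rfl) hP, map_zero]

end WeylAlgebra

end Simplicity

/-! ### Equivariance and invariants -/

section Equivariance

open MvPolynomial WeylField

variable {n : ℕ} {k : Type*} [Field k]

theorem weylAction_evalX (A : Matrix.GeneralLinearGroup (Fin n) k) (p : MvPolynomial (Fin n) k) :
    weylAction A (WeylAlgebra.evalX p) = WeylAlgebra.evalX (polynomialAction A p) := by
  have hx (i : Fin n) : weylAction A (WeylAlgebra.x k i) =
      ∑ j, (A⁻¹ : Matrix.GeneralLinearGroup (Fin n) k).1 i j • WeylAlgebra.x k j :=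
    WeylAlgebra.lift_x ..
  have hX (i : Fin n) : polynomialAction A (X i) =
      ∑ j, (A⁻¹ : Matrix.GeneralLinearGroup (Fin n) k).1 i j • (X j : MvPolynomial (Fin n) k) :=
    aeval_X ..
  induction p using MvPolynomial.induction_on with
  | C c => simp only [← MvPolynomial.algebraMap_eq, AlgHom.commutes, AlgEquiv.commutes]
  | add p q hp hq => simp only [map_add, hp, hq]
  | mul_X p i hp =>
    simp only [map_mul, hp, WeylAlgebra.evalX_X, hx, hX, map_sum, map_smul]

/-- The action of `A ∈ GLₙ(k)` on the field `k(x₁, …, xₙ)`. -/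
noncomputable def fractionAction (A : Matrix.GeneralLinearGroup (Fin n) k) :
    FractionRing (MvPolynomial (Fin n) k) ≃ₐ[k] FractionRing (MvPolynomial (Fin n) k) :=
  IsFractionRing.algEquivOfAlgEquiv (polynomialAction A)

theorem fractionAction_algebraMap (A : Matrix.GeneralLinearGroup (Fin n) k)
    (p : MvPolynomial (Fin n) k) :
    fractionAction A (algebraMap _ _ p) = algebraMap _ _ (polynomialAction A p) :=
  IsFractionRing.algEquivOfAlgEquiv_algebraMap _ p

theorem fractionAction_X (A : Matrix.GeneralLinearGroup (Fin n) k) (i : Fin n) :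
    fractionAction A (algebraMap (MvPolynomial (Fin n) k) _ (X i)) =
      ∑ j, (A⁻¹ : Matrix.GeneralLinearGroup (Fin n) k).1 i j •
        algebraMap (MvPolynomial (Fin n) k) _ (X j) := by
  have hX : polynomialAction A (X i) =
      ∑ j, (A⁻¹ : Matrix.GeneralLinearGroup (Fin n) k).1 i j • (X j : MvPolynomial (Fin n) k) :=
    aeval_X ..
  rw [fractionAction_algebraMap, hX, map_sum]
  simp only [algebraMap.coe_smul]

theorem map_weylAction_ofFrac (A : Matrix.GeneralLinearGroup (Fin n) k)
    (a : FractionRing (MvPolynomial (Fin n) k)) :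
    map (weylAction A) (ofFrac n k a) = ofFrac n k (fractionAction A a) := by
  have h (p : MvPolynomial (Fin n) k) : map (weylAction A) (ofFrac n k (algebraMap _ _ p)) =
      ofFrac n k (fractionAction A (algebraMap _ _ p)) := by
    rw [ofFrac_algebraMap, map_ofWeyl, weylAction_evalX, fractionAction_algebraMap,
      ofFrac_algebraMap]
  obtain ⟨p, q, -, rfl⟩ := IsFractionRing.div_surjective (A := MvPolynomial (Fin n) k) a
  simp only [map_div₀, h]

/-- A commutative ring is integral over the invariants of a finite group. -/
theorem isIntegral_invariants {G B : Type*} [Group G] [Finite G] [CommRing B] [Algebra k B]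
    (φ : G →* (B ≃ₐ[k] B)) : Algebra.IsIntegral (invariants φ) B := by
  let : MulSemiringAction G B := MulSemiringAction.compHom B φ
  have : Algebra.IsInvariant (invariants φ) B G := ⟨fun b hb => ⟨⟨b, hb⟩, rfl⟩⟩
  exact Algebra.IsInvariant.isIntegral (invariants φ) B G

theorem sum_mem_invariants {G B : Type*} [Group G] [Fintype G] [Semiring B] [Algebra k B]
    (φ : G →* (B ≃ₐ[k] B)) (b : B) : ∑ g, φ g b ∈ invariants φ := fun h => by
  rw [map_sum]
  refine Fintype.sum_equiv (Equiv.mulLeft h) _ _ fun g => ?_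
  rw [Equiv.coe_mulLeft, map_mul, AlgEquiv.mul_apply]

end Equivariance

/-! ### Coordinates on a rational quotient -/

section Rationality

universe u

open MvPolynomial

variable {n : ℕ} {k : Type*} [Field k]

/-- An integral extension of domains in characteristic zero induces an algebraic, hence separable and
formally étale, extension of fraction fields, and preserves the transcendence degree. -/
theorem exists_fractionField_hom_of_isIntegral {k S R : Type*} {L K : Type u} [Field k] [CharZero k]
    [CommRing S] [IsDomain S] [CommRing R] [IsDomain R] [Field L] [Field K] [Algebra k S]
    [Algebra k R] [Algebra k L] [Algebra k K] [Algebra S L] [IsFractionRing S L] [Algebra R K]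
    [IsFractionRing R K] [IsScalarTower k S L] [IsScalarTower k R K]
    (i : S →ₐ[k] R) (hi : Function.Injective i) (hint : i.toRingHom.IsIntegral) :
    ∃ j : L →ₐ[k] K, (∀ s, j (algebraMap S L s) = algebraMap R K (i s)) ∧
      j.toRingHom.FormallyEtale ∧
      Algebra.trdeg k L = Algebra.trdeg k K := by
  have hinj : Function.Injective ((IsScalarTower.toAlgHom k R K).comp i) :=
    (IsFractionRing.injective R K).comp hi
  let j : L →ₐ[k] K := IsFractionRing.liftAlgHom hinj
  have hj (s : S) : j (algebraMap S L s) = algebraMap R K (i s) :=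
    IsFractionRing.lift_algebraMap (g := ((IsScalarTower.toAlgHom k R K).comp i).toRingHom) hinj s
  let : Algebra L K := j.toRingHom.toAlgebra
  let : Algebra S R := i.toRingHom.toAlgebra
  let : Algebra S K := ((algebraMap R K).comp i.toRingHom).toAlgebra
  have : IsScalarTower S L K := .of_algebraMap_eq fun s => (hj s).symm
  have : IsScalarTower S R K := .of_algebraMap_eq fun s => rfl
  have : IsScalarTower k L K := .of_algebraMap_eq' j.comp_algebraMap.symm
  have : Algebra.IsIntegral S R := ⟨hint⟩
  have : Algebra.IsAlgebraic R K :=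
    (IsFractionRing.comap_isAlgebraic_iff (A := R) (K := K)).mpr inferInstance
  have : Algebra.IsAlgebraic S K := Algebra.IsAlgebraic.trans S R K
  have : Algebra.IsAlgebraic L K := (IsFractionRing.comap_isAlgebraic_iff (A := S)).mp this
  have : CharZero L := charZero_of_injective_algebraMap (algebraMap k L).injective
  refine ⟨j, hj, Algebra.FormallyEtale.of_isSeparable L K, ?_⟩
  have h := lift_trdeg_add_eq k L K
  rw [trdeg_eq_zero (R := L) (A := K), Cardinal.lift_zero, add_zero] at h
  simpa using h

theorem trdeg_fractionRing_mvPolynomial (k : Type*) [Field k] (m : ℕ) :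
    Algebra.trdeg k (FractionRing (MvPolynomial (Fin m) k)) = m := by
  have := lift_trdeg_add_eq k (MvPolynomial (Fin m) k)
    (FractionRing (MvPolynomial (Fin m) k))
  have h : Algebra.IsAlgebraic (MvPolynomial (Fin m) k) (FractionRing (MvPolynomial (Fin m) k)) :=
    (IsFractionRing.comap_isAlgebraic_iff (A := MvPolynomial (Fin m) k)
      (K := FractionRing (MvPolynomial (Fin m) k))).mpr inferInstance
  rw [trdeg_eq_zero (R := MvPolynomial (Fin m) k), MvPolynomial.trdeg_of_isDomain] at this
  simpa using this.symm

theorem RingEquiv.formallyEtale {A B : Type*} [CommRing A] [CommRing B] (e : A ≃+* B) :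
    e.toRingHom.FormallyEtale := by
  let : Algebra A B := e.toRingHom.toAlgebra
  exact Algebra.FormallyEtale.of_equiv (A := A) (AlgEquiv.ofRingEquiv (f := e) fun _ => rfl)

/-- If the quotient is rational, then `k(x₁, …, xₙ)` contains invariant elements `yᵢ = f (Xᵢ)`, equal
in number to the `xᵢ`, such that `k(x₁, …, xₙ)` is formally étale over `k[y₁, …, yₙ]` and
`k(y₁, …, yₙ)` contains all invariant polynomials. -/
theorem exists_generators_of_isRationalVariety [CharZero k] {G : Type*} [Group G] [Finite G]
    (ρ : G →* Matrix.GeneralLinearGroup (Fin n) k)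
    (hrat : IsRationalVariety k (polynomialInvariants ρ)) :
    ∃ f : FractionRing (MvPolynomial (Fin n) k) →ₐ[k] FractionRing (MvPolynomial (Fin n) k),
      (f.comp (IsScalarTower.toAlgHom k (MvPolynomial (Fin n) k) _)).toRingHom.FormallyEtale ∧
      (∀ s ∈ polynomialInvariants ρ, ∃ a, f a = algebraMap (MvPolynomial (Fin n) k) _ s) ∧
      ∀ g a, fractionAction (ρ g) (f a) = f a := by
  obtain ⟨m, ⟨e⟩⟩ := hrat
  obtain ⟨j, hj, hjet, htr⟩ := exists_fractionField_hom_of_isIntegral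
    (L := FractionRing (polynomialInvariants ρ)) (K := FractionRing (MvPolynomial (Fin n) k))
    (polynomialInvariants ρ).val Subtype.val_injective
    (isIntegral_invariants (polynomialAction.comp ρ)).1
  -- Comparing transcendence degrees shows that the number of generators is `n`.
  have hmn : m = n := by
    rw [e.trdeg_eq, trdeg_fractionRing_mvPolynomial,
      trdeg_fractionRing_mvPolynomial] at htr
    exact_mod_cast htr
  subst hmn
  refine ⟨j.comp e.symm.toAlgHom, ?_, fun s hs => ?_, fun g a => ?_⟩
  · have h1 : (e.symm.toAlgHom.toRingHom).FormallyEtale :=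
      e.symm.toRingEquiv.formallyEtale
    have h2 : (algebraMap (MvPolynomial (Fin m) k)
        (FractionRing (MvPolynomial (Fin m) k))).FormallyEtale :=
      (RingHom.formallyEtale_algebraMap).mpr
        (Algebra.FormallyEtale.of_isLocalization (nonZeroDivisors (MvPolynomial (Fin m) k)))
    exact (h2.comp h1).comp hjet
  · refine ⟨e (algebraMap (polynomialInvariants ρ) _ ⟨s, hs⟩), ?_⟩
    change j (e.symm (e _)) = _
    rw [AlgEquiv.symm_apply_apply, hj]
    rfl
  · change fractionAction (ρ g) (j (e.symm a)) = j (e.symm a)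
    obtain ⟨s, t, -, h⟩ := IsFractionRing.div_surjective (A := polynomialInvariants ρ) (e.symm a)
    rw [← h, map_div₀, map_div₀, hj, hj, fractionAction_algebraMap, fractionAction_algebraMap]
    exact congrArg₂ (fun a b => algebraMap _ (FractionRing (MvPolynomial (Fin m) k)) a /
      algebraMap _ (FractionRing (MvPolynomial (Fin m) k)) b) (s.2 g) (t.2 g)

end Rationality

/-! ### The Weyl field over the subfield of a coordinate system -/

section Descent

open MvPolynomial WeylField

/-- If a finite-dimensional left subspace is stable under right multiplication by `s ≠ 0`, then it is
stable under right multiplication by `s⁻¹`: an injective linear endomorphism is surjective. -/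
theorem Submodule.mul_inv_mem_of_mul_mem {F : Type*} [DivisionRing F] {E : Subfield F}
    (M : Submodule E F) [Module.Finite E M] {s : F} (hs : s ≠ 0) (h : ∀ z ∈ M, z * s ∈ M)
    {z : F} (hz : z ∈ M) : z * s⁻¹ ∈ M := by
  let f : M →ₗ[E] M :=
    { toFun := fun z => ⟨z * s, h z z.2⟩
      map_add' := fun a b => Subtype.ext (add_mul _ _ _)
      map_smul' := fun c a => Subtype.ext (smul_mul_assoc _ _ _) }
  have hf : Function.Injective f := fun a b hab =>
    Subtype.ext (mul_right_cancel₀ hs (congrArg Subtype.val hab))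
  obtain ⟨w, hw⟩ := LinearMap.injective_iff_surjective.mp hf ⟨z, hz⟩
  have hw' : w.1 * s = z := congrArg Subtype.val hw
  rw [← hw', mul_inv_cancel_right₀ hs]
  exact w.2

variable {n : ℕ} {k : Type*} [Field k]

theorem Derivation.sum_smul_apply {ι K : Type*} [Fintype ι] [Field K] [Algebra k K] (a : ι → K)
    (D : ι → Derivation k K K) (b : K) : (∑ i, a i • D i) b = ∑ i, a i * D i b :=
  (congrFun (map_sum Derivation.coeFnAddMonoidHom (fun i => a i • D i) _) b).trans
    (Finset.sum_apply _ _ _)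

namespace WeylField

theorem ofDer_sum_smul (a : Fin n → FractionRing (MvPolynomial (Fin n) k))
    (D : Fin n → Derivation k (FractionRing (MvPolynomial (Fin n) k))
      (FractionRing (MvPolynomial (Fin n) k))) :
    ofDer (∑ i, a i • D i) = ∑ i, ofFrac n k (a i) * ofDer (D i) := by
  simp only [ofDer, Derivation.sum_smul_apply, map_sum, map_mul, Finset.sum_mul,
    Finset.mul_sum, mul_assoc]
  exact Finset.sum_comm

/-- In any coordinate system `y` of the function field, `∂ⱼ = ∑ᵢ (∂yᵢ/∂xⱼ) ∂/∂yᵢ`. -/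
theorem exists_ofWeyl_d_eq_sum
    (φ : MvPolynomial (Fin n) k →ₐ[k] FractionRing (MvPolynomial (Fin n) k))
    (hφ : φ.toRingHom.FormallyEtale)
    {D : Fin n → Derivation k (FractionRing (MvPolynomial (Fin n) k))
      (FractionRing (MvPolynomial (Fin n) k))}
    (hD : ∀ i j, D i (φ (X j)) = if i = j then 1 else 0) (j : Fin n) :
    ∃ a : Fin n → FractionRing (MvPolynomial (Fin n) k),
      ofWeyl n k (WeylAlgebra.d k j) = ∑ i, ofFrac n k (a i) * ofDer (D i) := by
  have hx : (IsScalarTower.toAlgHom k (MvPolynomial (Fin n) k)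
      (FractionRing (MvPolynomial (Fin n) k))).toRingHom.FormallyEtale :=
    (RingHom.formallyEtale_algebraMap).mpr
      (Algebra.FormallyEtale.of_isLocalization (nonZeroDivisors (MvPolynomial (Fin n) k)))
  obtain ⟨P, hP⟩ := exists_dual_derivations _ hx
  have hPX (i : Fin n) : P j (algebraMap (MvPolynomial (Fin n) k) _ (X i)) =
    if j = i then 1 else 0 := hP j i
  have h : P j = ∑ i, P j (φ (X i)) • D i := by
    refine derivation_eq_of_formallyEtale φ hφ fun l => ?_
    simp [Derivation.sum_smul_apply, hD]
  refine ⟨fun i => P j (φ (X i)), ?_⟩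
  rw [← ofDer_sum_smul, ← h, ofDer]
  simp only [hPX]
  rw [Finset.sum_eq_single j (fun i _ hi => by rw [if_neg (Ne.symm hi), map_zero, zero_mul])
    (fun h => absurd (Finset.mem_univ j) h), if_pos rfl, map_one, one_mul]

section Span

variable (E : Subfield (WeylField n k))

/-- The left `E`-subspace of the Weyl field spanned by the polynomials in the `xᵢ`. -/
noncomputable def polySpan : Submodule E (WeylField n k) :=
  Submodule.span E (Set.range fun p : MvPolynomial (Fin n) k => ofWeyl n k (WeylAlgebra.evalX p))

variable {E}

/-- If `E` contains the polynomials in `S`, and `k[x₁, …, xₙ]` is integral over `S`, then it is a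
finite `S`-module, so its left `E`-span is finite-dimensional. -/
theorem finite_polySpan (S : Subalgebra k (MvPolynomial (Fin n) k))
    [Algebra.IsIntegral S (MvPolynomial (Fin n) k)]
    (hS : ∀ s ∈ S, ofWeyl n k (WeylAlgebra.evalX s) ∈ E) :
    Module.Finite E (polySpan E) := by
  classical
  have : Algebra.FiniteType S (MvPolynomial (Fin n) k) := .of_restrictScalars_finiteType k S _
  have : Module.Finite S (MvPolynomial (Fin n) k) := Algebra.IsIntegral.finite
  obtain ⟨b, hb⟩ := this.fg_top
  refine Module.Finite.iff_fg.mpr ⟨b.image fun p => ofWeyl n k (WeylAlgebra.evalX p),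
    le_antisymm (Submodule.span_mono ?_) (Submodule.span_le.mpr ?_)⟩
  · intro z hz
    obtain ⟨p, -, rfl⟩ := Finset.mem_image.mp hz
    exact ⟨p, rfl⟩
  · rintro _ ⟨p, rfl⟩
    have hp : p ∈ Submodule.span S (b : Set (MvPolynomial (Fin n) k)) := hb ▸ Submodule.mem_top
    dsimp only
    induction hp using Submodule.span_induction with
    | mem p hp =>
      exact Submodule.subset_span (Finset.mem_image_of_mem
        (fun p => ofWeyl n k (WeylAlgebra.evalX p)) hp)
    | zero => rw [map_zero, map_zero]; exact zero_mem _
    | add p q _ _ hp hq => rw [map_add, map_add]; exact add_mem hp hq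
    | smul s p _ hp =>
      have : ofWeyl n k (WeylAlgebra.evalX (s • p)) =
          (⟨_, hS s s.2⟩ : E) • ofWeyl n k (WeylAlgebra.evalX p) := by
        rw [Subalgebra.smul_def, smul_eq_mul, map_mul, map_mul]
        rfl
      rw [this]
      exact Submodule.smul_mem _ _ hp

/-- Rational functions lie in the `E`-span of the polynomials, since by integrality they can be written
with a denominator in `S`. -/
theorem ofFrac_mem_polySpan (S : Subalgebra k (MvPolynomial (Fin n) k))
    [Algebra.IsIntegral S (MvPolynomial (Fin n) k)]
    (hS : ∀ s ∈ S, ofWeyl n k (WeylAlgebra.evalX s) ∈ E)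
    (a : FractionRing (MvPolynomial (Fin n) k)) : ofFrac n k a ∈ polySpan E := by
  obtain ⟨p, q, hq, rfl⟩ := IsFractionRing.div_surjective (A := MvPolynomial (Fin n) k) a
  obtain ⟨s, hs, r, hr⟩ := (Algebra.IsIntegral.isIntegral (R := S) q).isAlgebraic.exists_nonzero_dvd
    hq
  have hr' : algebraMap _ (FractionRing (MvPolynomial (Fin n) k)) s.1 =
      algebraMap _ _ q * algebraMap _ _ r :=
    (congrArg (algebraMap _ _) hr).trans (map_mul _ _ _)
  have hs0 : algebraMap _ (FractionRing (MvPolynomial (Fin n) k)) s.1 ≠ 0 :=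
    (map_ne_zero_iff _ (IsFractionRing.injective _ _)).mpr (by simpa using hs)
  have h : algebraMap _ (FractionRing (MvPolynomial (Fin n) k)) p / algebraMap _ _ q =
      (algebraMap _ _ s.1)⁻¹ * algebraMap _ _ (r * p) := by
    have h0 := hr' ▸ hs0
    have hr0 := right_ne_zero_of_mul h0
    have hq0 := left_ne_zero_of_mul h0
    rw [hr', map_mul]
    field_simp
  have hE : ofFrac n k (algebraMap _ _ s.1)⁻¹ ∈ E := by
    rw [map_inv₀, ofFrac_algebraMap]
    exact inv_mem (hS _ s.2)
  rw [h, map_mul, ofFrac_algebraMap]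
  exact Submodule.smul_mem (polySpan E) (⟨_, hE⟩ : E) (Submodule.subset_span ⟨_, rfl⟩)

/-- If `E` contains the polynomials in `S` and the vector fields `∂/∂yᵢ`, then the Weyl field is
spanned by the polynomials over `E`. Indeed the span is stable under right multiplication by the
Weyl algebra, as `b ∂/∂yᵢ = ∂/∂yᵢ b - ∂b/∂yᵢ` for `b` in `k(x₁, …, xₙ)`; being finite-dimensional, it
is also stable under right multiplication by inverses of elements of the Weyl algebra. -/
theorem polySpan_eq_top (S : Subalgebra k (MvPolynomial (Fin n) k))
    [Algebra.IsIntegral S (MvPolynomial (Fin n) k)]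
    (hS : ∀ s ∈ S, ofWeyl n k (WeylAlgebra.evalX s) ∈ E)
    (φ : MvPolynomial (Fin n) k →ₐ[k] FractionRing (MvPolynomial (Fin n) k))
    (hφ : φ.toRingHom.FormallyEtale)
    {D : Fin n → Derivation k (FractionRing (MvPolynomial (Fin n) k))
      (FractionRing (MvPolynomial (Fin n) k))}
    (hD : ∀ i j, D i (φ (X j)) = if i = j then 1 else 0) (hDE : ∀ i, ofDer (D i) ∈ E)
    (z : WeylField n k) : z ∈ polySpan E := by
  have hfin := finite_polySpan S hS
  have hK := ofFrac_mem_polySpan S hS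
  -- A right multiplier of the span need only be tested on polynomials.
  have hmul {t : WeylField n k} (ht : ∀ p : MvPolynomial (Fin n) k,
      ofWeyl n k (WeylAlgebra.evalX p) * t ∈ polySpan E) :
      ∀ z ∈ polySpan E, z * t ∈ polySpan E := by
    intro z hz
    induction hz using Submodule.span_induction with
    | mem z hz => obtain ⟨p, rfl⟩ := hz; exact ht p
    | zero => rw [zero_mul]; exact zero_mem _
    | add a b _ _ ha hb => rw [add_mul]; exact add_mem ha hb
    | smul c a _ ha => rw [smul_mul_assoc]; exact Submodule.smul_mem _ _ ha
  have hW (P : WeylAlgebra n k) : ∀ z ∈ polySpan E, z * ofWeyl n k P ∈ polySpan E := by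
    induction P using WeylAlgebra.induction with
    | hx i =>
      refine hmul fun p => ?_
      rw [← WeylAlgebra.evalX_X, ← map_mul, ← map_mul]
      exact Submodule.subset_span ⟨_, rfl⟩
    | hd j =>
      refine hmul fun p => ?_
      obtain ⟨a, ha⟩ := exists_ofWeyl_d_eq_sum φ hφ hD j
      rw [ha, Finset.mul_sum]
      refine sum_mem fun i _ => ?_
      rw [← ofFrac_algebraMap, ← mul_assoc, ← map_mul,
        eq_sub_of_add_eq (ofDer_mul_ofFrac (D i) _).symm]
      exact sub_mem (Submodule.smul_mem (polySpan E) (⟨_, hDE i⟩ : E) (hK _)) (hK _)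
    | hc c =>
      intro z hz
      rw [AlgHom.commutes, ← Algebra.commutes]
      have hc : algebraMap k (WeylField n k) c ∈ E := by
        have := hS _ (S.algebraMap_mem c)
        rwa [AlgHom.commutes, AlgHom.commutes] at this
      exact Submodule.smul_mem (polySpan E) (⟨_, hc⟩ : E) hz
    | hadd a b ha hb =>
      intro z hz
      rw [map_add, mul_add]
      exact add_mem (ha z hz) (hb z hz)
    | hmul a b ha hb =>
      intro z hz
      rw [map_mul, ← mul_assoc]
      exact hb _ (ha z hz)
  obtain ⟨P, Q, hQ, h⟩ := exists_ofWeyl_mul_eq z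
  have h1 : (1 : WeylField n k) ∈ polySpan E := Submodule.subset_span ⟨1, by simp⟩
  have h2 := hW P _ ((polySpan E).mul_inv_mem_of_mul_mem (ofWeyl_ne_zero hQ) (hW Q) h1)
  rwa [one_mul, ← h, inv_mul_cancel_left₀ (ofWeyl_ne_zero hQ)] at h2

/-- If the Weyl field is spanned by the polynomials over a subfield `E` of invariants which contains the
invariant polynomials, then `E` contains all invariants: averaging over `G` is left `E`-linear and
maps polynomials to invariant polynomials. -/
theorem mem_of_mem_weylFieldInvariants [CharZero k] {G : Type*} [Group G] [Finite G]
    (ρ : G →* Matrix.GeneralLinearGroup (Fin n) k)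
    (hE : ∀ z ∈ E, z ∈ weylFieldInvariants ρ)
    (hS : ∀ s ∈ polynomialInvariants ρ, ofWeyl n k (WeylAlgebra.evalX s) ∈ E)
    (htop : ∀ z, z ∈ polySpan E) {z : WeylField n k} (hz : z ∈ weylFieldInvariants ρ) :
    z ∈ E := by
  have := Fintype.ofFinite G
  have hsum : ∀ z ∈ polySpan E, ∑ g, map (weylAction (ρ g)) z ∈ E := by
    intro z hz
    induction hz using Submodule.span_induction with
    | mem z hz =>
      obtain ⟨p, rfl⟩ := hz
      simp only [map_ofWeyl, weylAction_evalX]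
      rw [← map_sum, ← map_sum]
      exact hS _ (sum_mem_invariants (polynomialAction.comp ρ) p)
    | zero => simp only [map_zero, Finset.sum_const_zero]; exact zero_mem _
    | add a b _ _ ha hb => simp only [map_add, Finset.sum_add_distrib]; exact add_mem ha hb
    | smul c a _ ha =>
      have h (g : G) : map (weylAction (ρ g)) (c • a) = c * map (weylAction (ρ g)) a := by
        refine (map_mul _ c.1 a).trans ?_
        rw [show map (weylAction (ρ g)) c.1 = c from hE _ c.2 g]
      simp only [h, ← Finset.mul_sum]
      exact mul_mem c.2 ha
  have h1 : ∑ g, map (weylAction (ρ g)) z = (Fintype.card G : WeylField n k) * z := by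
    have hz' (g : G) : map (weylAction (ρ g)) z = z := hz g
    simp only [hz', Finset.sum_const, Finset.card_univ, nsmul_eq_mul]
  have h2 := h1 ▸ hsum z (htop z)
  have : CharZero (WeylField n k) :=
    charZero_of_injective_algebraMap (algebraMap k (WeylField n k)).injective
  have h0 : (Fintype.card G : WeylField n k) ≠ 0 := by simp
  rw [← inv_mul_cancel_left₀ h0 z]
  exact mul_mem (inv_mem (natCast_mem E _)) h2

end Span

end WeylField

end Descent

/-- Let `G` be a finite group acting linearly on `kⁿ`, where `k` is a field of characteristic zero.
If the quotient variety `𝔸ⁿ(k)/G` is rational, then the invariants `Fₙ(k)^G` of the Weyl field are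
isomorphic to `Fₙ(k)` as a `k`-algebra. -/
theorem theorem1p1 (k : Type*) [Field k] [CharZero k] (n : ℕ) (G : Type*) [Group G] [Finite G]
    (ρ : G →* Matrix.GeneralLinearGroup (Fin n) k)
    (hrat : IsRationalVariety k (polynomialInvariants ρ)) :
    Nonempty (weylFieldInvariants ρ ≃ₐ[k] WeylField n k) := by
  obtain ⟨f, hf, hfS, hfG⟩ := exists_generators_of_isRationalVariety ρ hrat
  obtain ⟨D, hD⟩ := exists_dual_derivations _ hf
  have hDf (i j : Fin n) : D i (f (algebraMap _ _ (MvPolynomial.X j : MvPolynomial (Fin n) k))) =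
    if i = j then 1 else 0 := hD i j
  -- Write `yᵢ = f (Xᵢ)`. Derivations are determined by their values on the `yᵢ`, so the
  -- `∂/∂yᵢ = D i` commute with each other and with the group.
  have hcomm (i j : Fin n) (a) : D i (D j a) = D j (D i a) := by
    have h : ⁅D i, D j⁆ = 0 := derivation_eq_of_formallyEtale _ hf fun l => by
      rw [Derivation.commutator_apply, hD, hD, Derivation.zero_apply]
      split_ifs <;> simp
    have := DFunLike.congr_fun h a
    rwa [Derivation.commutator_apply, Derivation.zero_apply, sub_eq_zero] at this
  have hinv (g : G) (i : Fin n) : WeylField.map (weylAction (ρ g)) (WeylField.ofDer (D i)) =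
      WeylField.ofDer (D i) := by
    refine WeylField.map_weylAction_ofDer (D i) (ρ g) (fractionAction (ρ g)).toAlgHom
      (map_weylAction_ofFrac _) (fun a => ?_) (fractionAction_X _)
    refine derivation_commute_of_formallyEtale _ hf (fractionAction (ρ g)) (fun l => hfG g _)
      (fun l => ?_) a
    rw [hD]
    split_ifs <;> simp
  -- The `yᵢ` and `∂/∂yᵢ` satisfy the Weyl relations, and generate a Weyl field of invariants.
  let Φ₀ : WeylAlgebra n k →ₐ[k] WeylField n k := WeylAlgebra.lift
    (fun i => WeylField.ofFrac n k
      (f (algebraMap _ _ (MvPolynomial.X i : MvPolynomial (Fin n) k))))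
    (fun i => WeylField.ofDer (D i)) (fun i j => WeylField.ofFrac_mul_comm _ _)
    (fun i j => WeylField.ofDer_mul_ofDer_comm _ _ (hcomm i j))
    (fun i j => by
      rw [WeylField.ofDer_mul_ofFrac, add_sub_cancel_left, hDf]
      split_ifs <;> simp)
  have hΦ₀x (i : Fin n) : Φ₀ (WeylAlgebra.x k i) = WeylField.ofFrac n k
      (f (algebraMap _ _ (MvPolynomial.X i : MvPolynomial (Fin n) k))) := WeylAlgebra.lift_x ..
  have hΦ₀d (i : Fin n) : Φ₀ (WeylAlgebra.d k i) = WeylField.ofDer (D i) := WeylAlgebra.lift_d ..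
  obtain ⟨Φ, hΦ⟩ := WeylField.exists_extension Φ₀ (WeylAlgebra.algHom_injective Φ₀)
  have hΦinv (z : WeylField n k) : Φ z ∈ weylFieldInvariants ρ := fun g => by
    have h : (WeylField.map (weylAction (ρ g))).toAlgHom.comp Φ₀ = Φ₀ := by
      refine WeylAlgebra.algHom_ext (fun i => ?_) (fun i => ?_)
      · change WeylField.map (weylAction (ρ g)) (Φ₀ _) = Φ₀ _
        rw [hΦ₀x, map_weylAction_ofFrac, hfG]
      · change WeylField.map (weylAction (ρ g)) (Φ₀ _) = Φ₀ _
        rw [hΦ₀d, hinv]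
    have h' : (WeylField.map (weylAction (ρ g))).toAlgHom.comp Φ = Φ :=
      WeylField.algHom_ext fun P => by
        change WeylField.map (weylAction (ρ g)) (Φ (WeylField.ofWeyl n k P)) =
          Φ (WeylField.ofWeyl n k P)
        rw [hΦ]
        exact DFunLike.congr_fun h P
    exact DFunLike.congr_fun h' z
  -- The subfield `E` they generate contains `k(y₁, …, yₙ)`, hence the invariant polynomials.
  let E : Subfield (WeylField n k) := (Φ : WeylField n k →+* WeylField n k).fieldRange
  have hΦE (z : WeylField n k) : Φ z ∈ E := ⟨z, rfl⟩
  have hpoly (p : MvPolynomial (Fin n) k) : WeylField.ofFrac n k (f (algebraMap _ _ p)) ∈ E := by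
    have h : (WeylField.ofFrac n k).comp (f.comp (IsScalarTower.toAlgHom k
        (MvPolynomial (Fin n) k) _)) = Φ₀.comp WeylAlgebra.evalX :=
      MvPolynomial.algHom_ext fun i => by
        change WeylField.ofFrac n k (f (algebraMap _ _ _)) = Φ₀ (WeylAlgebra.evalX _)
        rw [WeylAlgebra.evalX_X, hΦ₀x]
    have h' : WeylField.ofFrac n k (f (algebraMap _ _ p)) = Φ₀ (WeylAlgebra.evalX p) :=
      DFunLike.congr_fun h p
    rw [h', ← hΦ]
    exact hΦE _
  have hS : ∀ s ∈ polynomialInvariants ρ,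
      WeylField.ofWeyl n k (WeylAlgebra.evalX s) ∈ E := fun s hs => by
    obtain ⟨a, ha⟩ := hfS s hs
    obtain ⟨p, q, -, rfl⟩ := IsFractionRing.div_surjective (A := MvPolynomial (Fin n) k) a
    rw [← WeylField.ofFrac_algebraMap, ← ha, map_div₀, map_div₀]
    exact div_mem (hpoly p) (hpoly q)
  have : Algebra.IsIntegral (polynomialInvariants ρ) (MvPolynomial (Fin n) k) :=
    isIntegral_invariants _
  have htop := WeylField.polySpan_eq_top (polynomialInvariants ρ) hS _ hf hD
    (fun i => by rw [← hΦ₀d, ← hΦ]; exact hΦE _)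
  refine ⟨(AlgEquiv.ofBijective (Φ.codRestrict (weylFieldInvariants ρ) hΦinv) ⟨fun a b h => ?_,
    fun z => ?_⟩).symm⟩
  · exact Φ.toRingHom.injective (congrArg Subtype.val h)
  · obtain ⟨w, hw⟩ := WeylField.mem_of_mem_weylFieldInvariants (E := E) ρ
      (by rintro _ ⟨w, rfl⟩; exact hΦinv w) hS htop z.2
    exact ⟨w, Subtype.ext hw⟩
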